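/- **Notation.** For $\gamma>0$ let $S_\gamma=\{z\in\mathcal R:|\arg z|<\gamma\pi/2\}$, where $\mathcal R$ is the Riemann surface of the logarithm. For a sequence $M=(M_p)_{p\ge0}$ of positive reals put $\mu_0=1$, $\mu_p=M_p/M_{p-1}$, $h_M(t)=\inf_{k\ge0}M_kt^k$ for $t>0$, and $\widehat M=(p!M_p)_p$; similarly $\nu_p$ for a sequence $N$. Write $M\in\mathcal{LC}$ if $1=M_0\le M_1$, $M$ is log-convex and $M_k^{1/k}\to\infty$; $M$ has (mg) if for some $C\ge1$, $M_{j+k}\le C^{j+k}M_jM_k$ for all $j,k$. Let $\gamma(M,N)\in[0,\infty]$ be the supremum of all $r>0$ with $\sup_{p\ge1}\frac{\mu_p^{1/r}}{p}\sum_{k\ge p}\nu_k^{-1/r}<\infty$ (and $0$ if there is no such $r$). A weight function is a continuous nondecreasing $\omega:[0,\infty)\to[0,\infty)$ with $\omega(0)=0$ and $\omega(t)\to\infty$ as $t\to\infty$. It is normalized if $\omega=0$ on $[0,1]$, it has $(\omega_3)$ if $\log t=o(\omega(t))$ as $t\to\infty$, and $\omega\in\mathcal W_0$ if it is normalized, has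 $(\omega_3)$, and $\varphi_\omega:t\mapsto\omega(e^t)$ is convex on $\mathbb R$. Put $\omega^\iota(t)=\omega(1/t)$ for $t>0$, $\varphi^*_\omega(x)=\sup_{y\ge0}(xy-\varphi_\omega(y))$ for $x\geq 0$, and $W^x_p=\exp(\frac1x\varphi^*_\omega(xp))$ for $x>0$, $p\ge0$; similarly $S^x$ is defined from $\sigma$. For weight functions with $\omega(t)=O(\sigma(t))$ as $t\to\infty$, let $\gamma(\sigma,\omega)\in[0,\infty]$ be the supremum of all $r>0$ such that for some $C>0$, $\int_1^\infty\omega(tu)u^{-1-1/r}\,du\le C\sigma(t)+C$ for all $t\ge0$ (and $0$ if there is no such $r$). For a sequence $M$ of positive reals, $\mathcal A_{\{M\}}(S)$ is the set of all $f$ holomorphic on $S$ with $\sup_{z\in S,\,p\ge0}|f^{(p)}(z)|/(h^pM_p)<\infty$ for some $h>0$, and $\mathcal A_{\{\widehat\Omega\}}(S)=\bigcup_{x>0}\mathcal A_{\{\widehat{W}^x\}}(S)$ with $\widehat W^x=(p!W^x_p)_p$. A function $f$ is flat at $0$ if $\lim_{z\to0,\,z\in S}f^{(p)}(z)=0$ for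 all $p\ge0$. **Theorem.** (I) Let $M,N\in\mathcal{LC}$ with $\mu_p\le\nu_p$ for all $p$ and $\gamma(M,N)>0$. For every $0<\gamma<\gamma(M,N)$ there are constants $K_1,K_2,K_3,K_4>0$ depending only on $M,N,\gamma$ such that for every $a>0$ there is a function $G_a$ holomorphic on $S_\gamma$ with $$K_1^{-a}h_M(K_1|\xi|)^{2aK_2}\le|G_a(\xi)|\le h_N(K_3|\xi|)^{aK_4/2}\qquad(\xi\in S_\gamma).$$ Moreover, if $N$ has (mg), then $G_a\in\mathcal A_{\{\widehat N\}}(S_\gamma)$ and $G_a$ is flat at $0$. If $M$ has (mg), then there is $K_5>0$, depending also on $a$, with $|G_a(\xi)|\ge K_1^{-a}h_M(K_5|\xi|)$ for all $\xi\in S_\gamma$. (II) Let $\sigma,\omega$ be weight functions with $\omega(t)=O(\sigma(t))$ as $t\to\infty$ and $\gamma(\sigma,\omega)>0$. For every $0<\gamma<\gamma(\sigma,\omega)$ there are constants $K_1,K_2,K_3,K_2',B>0$ depending only on $\sigma,\omega,\gamma$, where $B=1$ whenever $\omega-\sigma$ is bounded above on $[0,\infty)$, such that for every $a>0$ there is a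 function $G_a$ holomorphic on $S_\gamma$ with $$K_1^{-a}\exp\bigl(-2aB\,\sigma^\iota(K_2|\xi|)\bigr)\le|G_a(\xi)|\le\exp\bigl(-\tfrac a2\,\omega^\iota(K_3|\xi|)\bigr)\qquad(\xi\in S_\gamma).$$ Moreover, if $\omega$ is normalized and has $(\omega_3)$, then $G_a\in\mathcal A_{\{\widehat\Omega\}}(S_\gamma)$, $G_a$ is flat at $0$, and $|G_a(\xi)|\le h_{W^{2/a}}(K_2'|\xi|)$ for all $\xi\in S_\gamma$. If $\sigma\in\mathcal W_0$, then there are $x>0$ and $K_4>0$, depending also on $a$, with $|G_a(\xi)|\ge K_4\,h_{S^x}(K_2|\xi|)$ for all $\xi\in S_\gamma$. -/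

import Mathlib

open Set Filter Topology

namespace MixedFlat

noncomputable section

/-! ### Weight sequences -/

/-- The quotients `μ_0 = 1`, `μ_p = M_p / M_{p-1}` for `p ≥ 1`. -/
def quot (M : ℕ → ℝ) : ℕ → ℝ
  | 0 => 1
  | p + 1 => M (p + 1) / M p

/-- The class `LC`: positive, normalized, log-convex sequences with `(M_k)^{1/k} → ∞`. -/
structure IsLC (M : ℕ → ℝ) : Prop where
  pos : ∀ p, 0 < M p
  zero_eq_one : M 0 = 1
  one_le_one : 1 ≤ M 1
  logConvex : ∀ j : ℕ, M (j + 1) ^ 2 ≤ M j * M (j + 2)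
  tendsto_root : Tendsto (fun k : ℕ => M k ^ (1 / (k : ℝ))) atTop atTop

/-- Moderate growth `(mg)`. -/
def ModerateGrowth (M : ℕ → ℝ) : Prop :=
  ∃ C : ℝ, 1 ≤ C ∧ ∀ j k : ℕ, M (j + k) ≤ C ^ (j + k) * M j * M k

/-- The mixed condition `(M,N)_{γ_r}`:
`sup_{p ≥ 1} (μ_p)^{1/r} / p * ∑_{k ≥ p} (1/ν_k)^{1/r} < ∞`. -/
def SeqGammaCond (M N : ℕ → ℝ) (r : ℝ) : Prop :=
  Summable (fun k : ℕ => (1 / quot N k) ^ (1 / r)) ∧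
    ∃ C : ℝ, ∀ p : ℕ, 1 ≤ p →
      quot M p ^ (1 / r) / (p : ℝ) * ∑' k : ℕ, (1 / quot N (p + k)) ^ (1 / r) ≤ C

/-- The mixed growth index `γ(M,N)`, with values in `[0,∞]`. -/
def seqIndex (M N : ℕ → ℝ) : ENNReal :=
  ⨆ r ∈ {r : ℝ | 0 < r ∧ SeqGammaCond M N r}, ENNReal.ofReal r

/-- `h_M(t) = inf_k M_k t^k`. -/
def hFun (M : ℕ → ℝ) (t : ℝ) : ℝ := ⨅ k : ℕ, M k * t ^ k

/-- The sequence `(p! M_p)_p`. -/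
def hat (M : ℕ → ℝ) (p : ℕ) : ℝ := (p.factorial : ℝ) * M p

/-! ### Weight functions -/

/-- Weight functions on `[0,∞)` (values of `ω` at negative arguments play no role). -/
structure IsWeightFunction (ω : ℝ → ℝ) : Prop where
  nonneg : ∀ t, 0 ≤ t → 0 ≤ ω t
  continuousOn : ContinuousOn ω (Ici 0)
  monotoneOn : MonotoneOn ω (Ici 0)
  zero : ω 0 = 0
  tendsto : Tendsto ω atTop atTop

/-- `(ω_0)`: `ω` is normalized. -/
def Normalized (ω : ℝ → ℝ) : Prop := ∀ t ∈ Icc (0 : ℝ) 1, ω t = 0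

/-- `(ω_3)`: `log t = o(ω(t))` as `t → ∞`. -/
def Omega3 (ω : ℝ → ℝ) : Prop := Asymptotics.IsLittleO atTop Real.log ω

/-- `φ_ω(t) = ω(e^t)`. -/
def phi (ω : ℝ → ℝ) (t : ℝ) : ℝ := ω (Real.exp t)

/-- `(ω_4)`: `φ_ω` is convex on `ℝ`. -/
def Omega4 (ω : ℝ → ℝ) : Prop := ConvexOn ℝ univ (phi ω)

/-- The class `W_0` of normalized weight functions with `(ω_3)` and `(ω_4)`. -/
structure IsW0 (ω : ℝ → ℝ) : Prop where
  weight : IsWeightFunction ω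
  normalized : Normalized ω
  omega3 : Omega3 ω
  omega4 : Omega4 ω

/-- `σ ⪯ ω`, that is `ω(t) = O(σ(t))` as `t → ∞`. -/
def WeightPreceq (σ ω : ℝ → ℝ) : Prop := Asymptotics.IsBigO atTop ω σ

/-- The mixed condition `(σ,ω)_{γ_r}`:
`∫_1^∞ ω(tu) / u^{1+1/r} du ≤ C σ(t) + C` for all `t ≥ 0`. -/
def FunGammaCond (σ ω : ℝ → ℝ) (r : ℝ) : Prop :=
  ∃ C : ℝ, 0 < C ∧ ∀ t : ℝ, 0 ≤ t →
    ∫⁻ u in Ioi (1 : ℝ), ENNReal.ofReal (ω (t * u) / u ^ (1 + 1 / r))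
      ≤ ENNReal.ofReal (C * σ t + C)

/-- The mixed growth index `γ(σ,ω)`, with values in `[0,∞]`. -/
def funIndex (σ ω : ℝ → ℝ) : ENNReal :=
  ⨆ r ∈ {r : ℝ | 0 < r ∧ FunGammaCond σ ω r}, ENNReal.ofReal r

/-- `ω^ι(t) = ω(1/t)`. -/
def iota (ω : ℝ → ℝ) (t : ℝ) : ℝ := ω (1 / t)

/-- The Legendre-Fenchel-Young conjugate `φ*_ω(x) = sup {x y - φ_ω(y) : y ≥ 0}`. -/
def conjPhi (ω : ℝ → ℝ) (x : ℝ) : ℝ :=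
  sSup ((fun y : ℝ => x * y - phi ω y) '' Ici 0)

/-- The weight matrix associated with `ω`: `W^l_j = exp (φ*_ω(l j) / l)`, `l > 0`. -/
def weightMatrix (ω : ℝ → ℝ) (l : ℝ) (j : ℕ) : ℝ :=
  Real.exp (1 / l * conjPhi ω (l * j))

/-! ### The Riemann surface of the logarithm and ultraholomorphic classes -/

/-- The Riemann surface of the logarithm, the universal covering `w ↦ exp w` of `ℂ \ {0}`.
A point is given by its logarithm `log |z| + i arg z`, which is a global holomorphic coordinate. -/
structure LogSurface where
  log : ℂ

/-- `|z|` -/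
def LogSurface.modulus (z : LogSurface) : ℝ := Real.exp z.log.re

/-- `arg z`, any real number -/
def LogSurface.arg (z : LogSurface) : ℝ := z.log.im

/-- The unbounded sector `S_γ` of opening `γπ`, bisected by direction `0`. -/
def sector (γ : ℝ) : Set LogSurface := {z | |z.arg| < γ * Real.pi / 2}

/-- Holomorphy on a (open) subset `S` of the surface. -/
def HolomorphicOn (f : LogSurface → ℂ) (S : Set LogSurface) : Prop :=
  DifferentiableOn ℂ (fun w : ℂ => f ⟨w⟩) {w : ℂ | (⟨w⟩ : LogSurface) ∈ S}

/-- The complex derivative `f'(z)` with respect to the variable `z = exp w`: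
by the chain rule `d/dz = exp(-w) d/dw`. -/
def zderiv (f : LogSurface → ℂ) (z : LogSurface) : ℂ :=
  Complex.exp (-z.log) * deriv (fun w : ℂ => f ⟨w⟩) z.log

/-- The Banach space `A_{M,h}(S)`, as a set of functions:
`sup_{z ∈ S, p} |f^{(p)}(z)| / (h^p M_p) < ∞`. -/
def ultraBanach (M : ℕ → ℝ) (h : ℝ) (S : Set LogSurface) : Set (LogSurface → ℂ) :=
  {f | HolomorphicOn f S ∧
    ∃ C : ℝ, ∀ z ∈ S, ∀ p : ℕ, ‖(zderiv^[p] f) z‖ / (h ^ p * M p) ≤ C}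

/-- The Roumieu class `A_{\{M\}}(S)`, the union over `h > 0`. -/
def ultraClass (M : ℕ → ℝ) (S : Set LogSurface) : Set (LogSurface → ℂ) :=
  ⋃ h ∈ Ioi (0 : ℝ), ultraBanach M h S

/-- The Roumieu class of a weight matrix `(W^x)_{x > 0}`, the union over `x > 0`. -/
def ultraMatrixClass (W : ℝ → ℕ → ℝ) (S : Set LogSurface) : Set (LogSurface → ℂ) :=
  ⋃ x ∈ Ioi (0 : ℝ), ultraClass (W x) S

/-- `f` is flat at `0`: for every `p`, `f^{(p)}(z) → 0` as `z → 0`, `z ∈ S`. -/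
def Flat (f : LogSurface → ℂ) (S : Set LogSurface) : Prop :=
  ∀ p : ℕ, Tendsto (zderiv^[p] f) (comap LogSurface.modulus (𝓝 0) ⊓ 𝓟 S) (𝓝 0)

end

end MixedFlat

namespace MixedFlat

open MeasureTheory

/-! ### The kernel `1 / (π cosh w)` on the strip `|Im w| < π / 2` -/

/-! In the coordinate `w = log ξ` the sector is the strip `|Im w| < γπ/2`, and `G = exp(-a H)` has
modulus `exp(-a Re H)`. So one holomorphic `H`, independent of `a`, is enough, provided `Re H` lies
between `ψ(Re w)/2` and a translate of `ψ + Φ + 1`. Here `ψ(s)` is `-log h_N(e^s)` in (I) and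
`ω(e^{-s})` in (II), and `Φ` is the analogue for `M` (up to a shift) or `σ`.

`H` is the convolution of `ψ` with `1/(π cosh)`. On `|Im w| < π/2` the real part of this kernel is
positive, even in `Re w`, of mass 1 on every horizontal line, and decays like `exp(-|Re w|)`. Since
`ψ` is nonincreasing, half of that mass sees values at least `ψ(Re w)`, which gives the lower bound.
The upper bound needs `ψ(x - v) ≤ A (Φ(x) + 1) e^{v/r}` for `v ≥ 0` and some `r > γ`. After
rescaling the strip, the kernel's decay beats this exponential and a translation swallows the
constant (`exists_strip`).

That growth estimate is what the index conditions provide: `SeqGammaCond.exists_neg_log_hFun_le` and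
`FunGammaCond.exists_le_rpow`. Flatness and membership in the classes follow from Cauchy estimates
on a slightly larger sector (`mem_ultraClass_and_flat`). Powers of `h_M` become dilations by
moderate growth, and `exp(-b σ(1/t))` is compared with the weight matrix by Legendre duality. -/

noncomputable def sechKernel (w : ℂ) : ℂ := 1 / (Real.pi * Complex.cosh w)

theorem sq_norm_cosh (x y : ℝ) :
    ‖Complex.cosh ⟨x, y⟩‖ ^ 2 = Real.sinh x ^ 2 + Real.cos y ^ 2 := by
  have h : (⟨x, y⟩ : ℂ) = x + y * Complex.I := Complex.mk_eq_add_mul_I x y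
  rw [h, Complex.cosh_add, Complex.cosh_mul_I, Complex.sinh_mul_I, ← Complex.normSq_eq_norm_sq,
    Complex.normSq_apply]
  simp only [← Complex.ofReal_cosh, ← Complex.ofReal_sinh, ← Complex.ofReal_cos,
    ← Complex.ofReal_sin, Complex.add_re, Complex.add_im, Complex.mul_re, Complex.mul_im,
    Complex.ofReal_re, Complex.ofReal_im, Complex.I_re, Complex.I_im]
  nlinarith [Real.cosh_sq x, Real.sin_sq_add_cos_sq y]

theorem re_cosh (x y : ℝ) : (Complex.cosh ⟨x, y⟩).re = Real.cosh x * Real.cos y := by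
  have h : (⟨x, y⟩ : ℂ) = x + y * Complex.I := Complex.mk_eq_add_mul_I x y
  rw [h, Complex.cosh_add, Complex.cosh_mul_I, Complex.sinh_mul_I]
  simp only [← Complex.ofReal_cosh, ← Complex.ofReal_sinh, ← Complex.ofReal_cos,
    ← Complex.ofReal_sin, Complex.add_re, Complex.mul_re, Complex.mul_im,
    Complex.ofReal_re, Complex.ofReal_im, Complex.I_re, Complex.I_im]
  ring

theorem re_sechKernel (x y : ℝ) :
    (sechKernel ⟨x, y⟩).re
      = Real.cosh x * Real.cos y / (Real.pi * (Real.sinh x ^ 2 + Real.cos y ^ 2)) := by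
  rw [sechKernel, one_div, Complex.inv_re, Complex.normSq_eq_norm_sq, norm_mul, mul_pow,
    sq_norm_cosh, Complex.re_ofReal_mul, re_cosh, Complex.norm_real, Real.norm_eq_abs,
    abs_of_pos Real.pi_pos]
  have := Real.pi_pos
  rw [sq Real.pi, mul_assoc Real.pi Real.pi, mul_div_mul_left _ _ this.ne']

/-- The modulus of `cosh` is bounded below on closed substrips. -/
theorem le_norm_cosh {θ : ℝ} (hθ : θ < Real.pi / 2) {w : ℂ} (hw : |w.im| ≤ θ) :
    Real.cos θ * Real.cosh w.re ≤ ‖Complex.cosh w‖ := by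
  have hθ0 : 0 ≤ θ := (abs_nonneg _).trans hw
  have hc : Real.cos θ ≤ Real.cos w.im := by
    rw [← Real.cos_abs w.im]
    exact Real.cos_le_cos_of_nonneg_of_le_pi (abs_nonneg _) (by linarith [Real.pi_pos]) hw
  have hc0 : 0 ≤ Real.cos θ := Real.cos_nonneg_of_mem_Icc ⟨by linarith, by linarith⟩
  have h := sq_norm_cosh w.re w.im
  refine le_of_sq_le_sq ?_ (norm_nonneg _)
  change _ ≤ ‖Complex.cosh ⟨w.re, w.im⟩‖ ^ 2
  rw [h, mul_pow, Real.cosh_sq]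
  have h1 : Real.cos θ ^ 2 ≤ Real.cos w.im ^ 2 := by gcongr
  have h2 : Real.cos θ ^ 2 ≤ 1 := Real.cos_sq_le_one _
  nlinarith [sq_nonneg (Real.sinh w.re)]

theorem cos_pos_of_lt {θ : ℝ} (hθ : θ < Real.pi / 2) (h0 : 0 ≤ θ) : 0 < Real.cos θ :=
  Real.cos_pos_of_mem_Ioo ⟨by linarith, hθ⟩

theorem inv_cosh_le (x : ℝ) : 1 / Real.cosh x ≤ 2 * Real.exp (-|x|) := by
  rw [div_le_iff₀ (Real.cosh_pos x), ← Real.cosh_abs, Real.cosh_eq, Real.exp_neg]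
  have := Real.exp_pos |x|
  have h2 : 0 < (Real.exp |x|)⁻¹ := by positivity
  have h3 : (Real.exp |x|)⁻¹ * Real.exp |x| = 1 := inv_mul_cancel₀ this.ne'
  nlinarith

theorem norm_sechKernel_le {θ : ℝ} (hθ : θ < Real.pi / 2) {w : ℂ} (hw : |w.im| ≤ θ) :
    ‖sechKernel w‖ ≤ 2 / (Real.pi * Real.cos θ) * Real.exp (-|w.re|) := by
  have h := le_norm_cosh hθ hw
  have hc := cos_pos_of_lt hθ ((abs_nonneg _).trans hw)
  have hp := Real.pi_pos
  have hx := Real.cosh_pos w.re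
  rw [sechKernel, norm_div, norm_one, norm_mul, Complex.norm_real, Real.norm_eq_abs,
    abs_of_pos hp]
  calc 1 / (Real.pi * ‖Complex.cosh w‖) ≤ 1 / (Real.pi * (Real.cos θ * Real.cosh w.re)) := by
        gcongr
    _ = 1 / (Real.pi * Real.cos θ) * (1 / Real.cosh w.re) := by field_simp
    _ ≤ 1 / (Real.pi * Real.cos θ) * (2 * Real.exp (-|w.re|)) := by
        gcongr
        exact inv_cosh_le _
    _ = _ := by ring

theorem cosh_ne_zero_of_abs_im_lt {w : ℂ} (hw : |w.im| < Real.pi / 2) : Complex.cosh w ≠ 0 := by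
  rw [← norm_pos_iff]
  refine lt_of_lt_of_le ?_ (le_norm_cosh hw le_rfl)
  exact mul_pos (cos_pos_of_lt hw (abs_nonneg _)) (Real.cosh_pos _)

theorem hasDerivAt_sechKernel {w : ℂ} (hw : |w.im| < Real.pi / 2) :
    HasDerivAt sechKernel (-(sechKernel w * (Complex.sinh w / Complex.cosh w))) w := by
  have h0 := cosh_ne_zero_of_abs_im_lt hw
  have hp : (Real.pi : ℂ) ≠ 0 := by exact_mod_cast Real.pi_ne_zero
  have h := (((Complex.hasDerivAt_cosh w).const_mul (Real.pi : ℂ)).inv (mul_ne_zero hp h0))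
  have he : sechKernel = (fun y : ℂ => Real.pi * Complex.cosh y)⁻¹ := by
    funext y; simp [sechKernel]
  rw [he]
  refine h.congr_deriv ?_
  rw [Pi.inv_apply]
  field_simp

theorem norm_sinh_le (w : ℂ) : ‖Complex.sinh w‖ ≤ Real.cosh w.re := by
  rw [Complex.sinh, Real.cosh_eq, norm_div, Complex.norm_two]
  have := norm_sub_le (Complex.exp w) (Complex.exp (-w))
  rw [Complex.norm_exp, Complex.norm_exp, Complex.neg_re] at this
  gcongr

theorem norm_sinh_div_cosh_le {θ : ℝ} (hθ : θ < Real.pi / 2) {w : ℂ} (hw : |w.im| ≤ θ) :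
    ‖Complex.sinh w / Complex.cosh w‖ ≤ 1 / Real.cos θ := by
  have h := le_norm_cosh hθ hw
  have hc := cos_pos_of_lt hθ ((abs_nonneg _).trans hw)
  have hx := Real.cosh_pos w.re
  rw [norm_div]
  calc _ ≤ Real.cosh w.re / (Real.cos θ * Real.cosh w.re) := by
        gcongr
        exact norm_sinh_le w
    _ = _ := by field_simp

theorem re_sechKernel_nonneg {x y : ℝ} (hy : |y| < Real.pi / 2) :
    0 ≤ (sechKernel ⟨x, y⟩).re := by
  rw [re_sechKernel]
  have hc : 0 < Real.cos y := Real.cos_pos_of_mem_Ioo (abs_lt.1 hy |>.imp (by intro h; linarith) id)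
  have := Real.cosh_pos x
  have := Real.pi_pos
  positivity

/-- An explicit primitive of the kernel's real part. Being odd with limits `±1/2`, it gives total
mass 1 and mass 1/2 on each half-line, whatever the height `y`. -/
theorem hasDerivAt_arctan_sinh {y : ℝ} (hy : |y| < Real.pi / 2) (x : ℝ) :
    HasDerivAt (fun x => Real.arctan (Real.sinh x / Real.cos y) / Real.pi)
      (sechKernel ⟨x, y⟩).re x := by
  have hc : 0 < Real.cos y := Real.cos_pos_of_mem_Ioo (abs_lt.1 hy |>.imp (by intro h; linarith) id)
  have h := (((Real.hasDerivAt_sinh x).div_const (Real.cos y)).arctan).div_const Real.pi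
  refine h.congr_deriv ?_
  rw [re_sechKernel]
  have := Real.pi_pos
  have h2 : Real.cos y ^ 2 + Real.sinh x ^ 2 ≠ 0 := by positivity
  have h3 : Real.sinh x ^ 2 + Real.cos y ^ 2 ≠ 0 := by positivity
  field_simp
  ring

theorem integrable_exp_neg_mul_abs {b : ℝ} (hb : 0 < b) :
    Integrable (fun x : ℝ => Real.exp (-(b * |x|))) := by
  rw [← integrableOn_univ, ← Iic_union_Ioi (a := (0 : ℝ))]
  refine IntegrableOn.union ?_ ?_
  · refine (integrableOn_exp_mul_Iic hb 0).congr_fun (fun x hx => ?_) measurableSet_Iic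
    simp [abs_of_nonpos (mem_Iic.1 hx)]
  · refine (integrableOn_exp_mul_Ioi (neg_neg_iff_pos.2 hb) 0).congr_fun (fun x hx => ?_)
      measurableSet_Ioi
    simp [abs_of_pos (mem_Ioi.1 hx)]

theorem tendsto_sinh_atTop : Tendsto Real.sinh atTop atTop := by
  refine tendsto_atTop_mono' _ ?_ tendsto_id
  filter_upwards [eventually_ge_atTop 0] with x hx
  exact Real.self_le_sinh_iff.2 hx

theorem continuous_sechKernel {y : ℝ} (hy : |y| < Real.pi / 2) :
    Continuous fun x : ℝ => sechKernel ⟨x, y⟩ := by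
  rw [continuous_iff_continuousAt]
  intro x
  have h1 : ContinuousAt sechKernel ⟨x, y⟩ := (hasDerivAt_sechKernel (w := ⟨x, y⟩) hy).continuousAt
  have h2 : Continuous fun x : ℝ => (⟨x, y⟩ : ℂ) := by
    have : (fun x : ℝ => (⟨x, y⟩ : ℂ)) = fun x : ℝ => (x : ℂ) + y * Complex.I := by
      funext x; exact Complex.mk_eq_add_mul_I x y
    rw [this]; fun_prop
  exact ContinuousAt.comp (f := fun x : ℝ => (⟨x, y⟩ : ℂ)) h1 h2.continuousAt

theorem integrable_re_sechKernel {y : ℝ} (hy : |y| < Real.pi / 2) :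
    Integrable fun x : ℝ => (sechKernel ⟨x, y⟩).re := by
  refine ((integrable_exp_neg_mul_abs one_pos).const_mul (2 / (Real.pi * Real.cos |y|))).mono'
    (Complex.continuous_re.comp (continuous_sechKernel hy)).aestronglyMeasurable
    (Eventually.of_forall fun x => ?_)
  refine (Complex.abs_re_le_norm _).trans ((norm_sechKernel_le hy le_rfl).trans_eq ?_)
  simp

theorem tendsto_arctan_sinh_atTop {y : ℝ} (hy : |y| < Real.pi / 2) :
    Tendsto (fun x => Real.arctan (Real.sinh x / Real.cos y) / Real.pi) atTop (𝓝 (1 / 2)) := by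
  have hc : 0 < Real.cos y := Real.cos_pos_of_mem_Ioo (abs_lt.1 hy |>.imp (by intro h; linarith) id)
  have h := ((Real.tendsto_arctan_atTop.mono_right nhdsWithin_le_nhds).comp
    (tendsto_sinh_atTop.atTop_div_const hc)).div_const Real.pi
  have he : Real.pi / 2 / Real.pi = 1 / 2 := by field_simp
  rw [he] at h
  exact h

theorem tendsto_arctan_sinh_atBot {y : ℝ} (hy : |y| < Real.pi / 2) :
    Tendsto (fun x => Real.arctan (Real.sinh x / Real.cos y) / Real.pi) atBot (𝓝 (-(1 / 2))) := by
  refine ((tendsto_arctan_sinh_atTop hy).comp tendsto_neg_atBot_atTop).neg.congr fun x => ?_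
  simp [neg_div]

theorem integral_re_sechKernel {y : ℝ} (hy : |y| < Real.pi / 2) :
    ∫ x : ℝ, (sechKernel ⟨x, y⟩).re = 1 := by
  rw [integral_of_hasDerivAt_of_tendsto (hasDerivAt_arctan_sinh hy) (integrable_re_sechKernel hy)
    (tendsto_arctan_sinh_atBot hy) (tendsto_arctan_sinh_atTop hy)]
  norm_num

theorem integral_Ioi_re_sechKernel {y : ℝ} (hy : |y| < Real.pi / 2) :
    ∫ x in Ioi (0 : ℝ), (sechKernel ⟨x, y⟩).re = 1 / 2 := by
  rw [integral_Ioi_of_hasDerivAt_of_tendsto' (fun x _ => hasDerivAt_arctan_sinh hy x)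
    (integrable_re_sechKernel hy).integrableOn (tendsto_arctan_sinh_atTop hy)]
  simp

/-! ### Convolution with the kernel -/

noncomputable def sechConv (ψ : ℝ → ℝ) (w : ℂ) : ℂ := ∫ s : ℝ, (ψ s : ℂ) * sechKernel (w - s)

section Conv

variable {ψ : ℝ → ℝ} {δ D : ℝ}

/-- A majorant uniform over the box `|Im w| ≤ θ`, `|Re w| ≤ R`. It is integrable in `s` once `δ <
1`, and serves both for convergence and for differentiation under the integral. -/
theorem norm_mul_sechKernel_le (h0 : ∀ s, 0 ≤ ψ s) (hD : ∀ s, ψ s ≤ D * Real.exp (δ * |s|))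
    {θ : ℝ} (hθ : θ < Real.pi / 2) {R : ℝ} {w : ℂ} (hw : |w.im| ≤ θ) (hR : |w.re| ≤ R) (s : ℝ) :
    ‖(ψ s : ℂ) * sechKernel (w - s)‖
      ≤ D * (2 / (Real.pi * Real.cos θ)) * Real.exp R * Real.exp (-((1 - δ) * |s|)) := by
  have hc := cos_pos_of_lt hθ ((abs_nonneg _).trans hw)
  have hp := Real.pi_pos
  have h1 : ‖sechKernel (w - s)‖ ≤ 2 / (Real.pi * Real.cos θ) * Real.exp (-|(w - s).re|) :=
    norm_sechKernel_le hθ (by simpa using hw)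
  have h2 : -|(w - s).re| ≤ R - |s| := by
    have : |s| - |w.re| ≤ |s - w.re| := abs_sub_abs_le_abs_sub _ _
    rw [abs_sub_comm] at this
    simp only [Complex.sub_re, Complex.ofReal_re]
    linarith
  have hD0 : 0 ≤ D * Real.exp (δ * |s|) := (h0 s).trans (hD s)
  rw [norm_mul, Complex.norm_real, Real.norm_eq_abs, abs_of_nonneg (h0 s)]
  calc _ ≤ (D * Real.exp (δ * |s|)) * (2 / (Real.pi * Real.cos θ) * Real.exp (R - |s|)) := by
        gcongr
        · exact hD s
        · refine h1.trans ?_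
          gcongr
    _ = D * (2 / (Real.pi * Real.cos θ)) * (Real.exp (δ * |s|) * Real.exp (R - |s|)) := by ring
    _ = _ := by
        rw [← Real.exp_add, mul_assoc _ (Real.exp R), ← Real.exp_add]
        ring_nf

theorem aestronglyMeasurable_mul_sechKernel (hψ : Antitone ψ) {w : ℂ} (hw : |w.im| < Real.pi / 2) :
    AEStronglyMeasurable fun s : ℝ => (ψ s : ℂ) * sechKernel (w - s) := by
  refine (Complex.measurable_ofReal.comp hψ.measurable).aestronglyMeasurable.mul ?_
  refine Continuous.aestronglyMeasurable (continuous_iff_continuousAt.2 fun s => ?_)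
  exact ContinuousAt.comp (f := fun s : ℝ => w - s)
    (hasDerivAt_sechKernel (by simpa using hw)).continuousAt (by fun_prop)

theorem integrable_mul_sechKernel (hψ : Antitone ψ) (h0 : ∀ s, 0 ≤ ψ s) (hδ : δ < 1)
    (hD : ∀ s, ψ s ≤ D * Real.exp (δ * |s|)) {w : ℂ} (hw : |w.im| < Real.pi / 2) :
    Integrable fun s : ℝ => (ψ s : ℂ) * sechKernel (w - s) :=
  ((integrable_exp_neg_mul_abs (sub_pos.2 hδ)).const_mul _).mono'
    (aestronglyMeasurable_mul_sechKernel hψ hw)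
    (Eventually.of_forall (norm_mul_sechKernel_le h0 hD hw le_rfl le_rfl))

theorem differentiableAt_sechConv (hψ : Antitone ψ) (h0 : ∀ s, 0 ≤ ψ s) (hδ : δ < 1)
    (hD : ∀ s, ψ s ≤ D * Real.exp (δ * |s|)) {w : ℂ} (hw : |w.im| < Real.pi / 2) :
    DifferentiableAt ℂ (sechConv ψ) w := by
  obtain ⟨θ, hθ1, hθ2⟩ := exists_between hw
  have hc := cos_pos_of_lt hθ2 ((abs_nonneg _).trans hθ1.le)
  have hs : {z : ℂ | |z.im| < θ ∧ |z.re| < |w.re| + 1} ∈ 𝓝 w := by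
    refine IsOpen.mem_nhds ?_ ⟨hθ1, lt_add_one _⟩
    exact (isOpen_lt Complex.continuous_im.abs continuous_const).inter
      (isOpen_lt Complex.continuous_re.abs continuous_const)
  refine (hasDerivAt_integral_of_dominated_loc_of_deriv_le (μ := volume)
    (F := fun z (s : ℝ) => (ψ s : ℂ) * sechKernel (z - s))
    (F' := fun z (s : ℝ) => (ψ s : ℂ) *
      (-(sechKernel (z - s) * (Complex.sinh (z - s) / Complex.cosh (z - s)))))
    (bound := fun s => D * (2 / (Real.pi * Real.cos θ)) * Real.exp (|w.re| + 1)
      * Real.exp (-((1 - δ) * |s|)) * (1 / Real.cos θ))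
    hs ?_ ?_ ?_ ?_ ?_ ?_).2.differentiableAt
  · filter_upwards [hs] with z hz
    exact aestronglyMeasurable_mul_sechKernel hψ (hz.1.trans hθ2)
  · exact integrable_mul_sechKernel hψ h0 hδ hD hw
  · have h1 := (aestronglyMeasurable_mul_sechKernel hψ hw).neg
    have h2 : AEStronglyMeasurable
        (fun s : ℝ => Complex.sinh (w - s) / Complex.cosh (w - s)) volume := by
      refine Continuous.aestronglyMeasurable (Continuous.div (by fun_prop) (by fun_prop) fun s => ?_)
      exact cosh_ne_zero_of_abs_im_lt (by simpa using hw)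
    refine (h1.mul h2).congr (Eventually.of_forall fun s => ?_)
    simp only [Pi.mul_apply, Pi.neg_apply]
    ring
  -- The derivative of the kernel is the kernel times `-tanh`, and `tanh` is bounded by `1 / cos θ`
  -- on the substrip, so the same majorant works.
  · refine Eventually.of_forall fun s z hz => ?_
    rw [mul_neg, norm_neg, ← mul_assoc, norm_mul]
    have h1 := norm_mul_sechKernel_le h0 hD hθ2 hz.1.le hz.2.le s
    have h2 : ‖Complex.sinh (z - s) / Complex.cosh (z - s)‖ ≤ 1 / Real.cos θ :=
      norm_sinh_div_cosh_le hθ2 (by simpa using hz.1.le)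
    exact mul_le_mul h1 h2 (norm_nonneg _) ((norm_nonneg _).trans h1)
  · exact ((integrable_exp_neg_mul_abs (sub_pos.2 hδ)).const_mul _).mul_const _
  · refine Eventually.of_forall fun s z hz => ?_
    have h1 := hasDerivAt_sechKernel (w := z - s) (by simpa using hz.1.trans hθ2)
    have h2 := h1.comp z ((hasDerivAt_id z).sub_const (s : ℂ))
    simpa using h2.const_mul (ψ s : ℂ)

/-- The real part of the convolution as an integral against the (positive) real part of the
kernel. -/
theorem re_sechConv (hψ : Antitone ψ) (h0 : ∀ s, 0 ≤ ψ s) (hδ : δ < 1)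
    (hD : ∀ s, ψ s ≤ D * Real.exp (δ * |s|)) {w : ℂ} (hw : |w.im| < Real.pi / 2) :
    Integrable (fun u : ℝ => ψ (w.re - u) * (sechKernel ⟨u, w.im⟩).re) ∧
    (sechConv ψ w).re = ∫ u : ℝ, ψ (w.re - u) * (sechKernel ⟨u, w.im⟩).re := by
  have hint := integrable_mul_sechKernel hψ h0 hδ hD hw
  have he : ∀ s : ℝ, ((ψ s : ℂ) * sechKernel (w - s)).re
      = ψ (w.re - (w.re - s)) * (sechKernel ⟨w.re - s, w.im⟩).re := by
    intro s
    rw [Complex.re_ofReal_mul, sub_sub_cancel]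
    congr 3
    apply Complex.ext <;> simp
  have hre := hint.re
  simp only [RCLike.re_eq_complex_re, he] at hre
  constructor
  · simpa using hre.comp_sub_left w.re
  · have h1 := integral_re hint
    simp only [RCLike.re_eq_complex_re, he] at h1
    rw [sechConv, ← h1]
    exact integral_sub_left_eq_self (fun u => ψ (w.re - u) * (sechKernel ⟨u, w.im⟩).re) volume w.re

/-- The mass on `u > 0` is 1/2, and there `ψ (w.re - u) ≥ ψ w.re`; the remaining contribution is
nonnegative. -/
theorem half_le_re_sechConv (hψ : Antitone ψ) (h0 : ∀ s, 0 ≤ ψ s) (hδ : δ < 1)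
    (hD : ∀ s, ψ s ≤ D * Real.exp (δ * |s|)) {w : ℂ} (hw : |w.im| < Real.pi / 2) :
    ψ w.re / 2 ≤ (sechConv ψ w).re := by
  obtain ⟨hi, he⟩ := re_sechConv hψ h0 hδ hD hw
  rw [he]
  calc ψ w.re / 2 = ∫ u in Ioi (0 : ℝ), ψ w.re * (sechKernel ⟨u, w.im⟩).re := by
        rw [integral_const_mul, integral_Ioi_re_sechKernel hw]; ring
    _ ≤ ∫ u in Ioi (0 : ℝ), ψ (w.re - u) * (sechKernel ⟨u, w.im⟩).re := by
        refine setIntegral_mono_on ((integrable_re_sechKernel hw).const_mul _).integrableOn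
          hi.integrableOn measurableSet_Ioi fun u hu => ?_
        exact mul_le_mul_of_nonneg_right (hψ (by linarith [mem_Ioi.1 hu]))
          (re_sechKernel_nonneg hw)
    _ ≤ _ := setIntegral_le_integral hi
        (Eventually.of_forall fun u => mul_nonneg (h0 _) (re_sechKernel_nonneg hw))

theorem integrable_exp_mul_re_sechKernel (hδ0 : 0 ≤ δ) (hδ : δ < 1) {y : ℝ}
    (hy : |y| < Real.pi / 2) :
    Integrable fun u : ℝ => Real.exp (δ * u) * (sechKernel ⟨u, y⟩).re := by
  refine ((integrable_exp_neg_mul_abs (sub_pos.2 hδ)).const_mul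
    (2 / (Real.pi * Real.cos |y|))).mono'
    ((by fun_prop : Continuous fun u : ℝ => Real.exp (δ * u)).mul
      (Complex.continuous_re.comp (continuous_sechKernel hy))).aestronglyMeasurable
    (Eventually.of_forall fun u => ?_)
  have h1 := (Complex.abs_re_le_norm _).trans (norm_sechKernel_le hy (w := ⟨u, y⟩) le_rfl)
  rw [norm_mul, Real.norm_eq_abs, Real.norm_eq_abs, Real.abs_exp]
  have h2 : δ * u ≤ δ * |u| := by gcongr; exact le_abs_self u
  have hc := cos_pos_of_lt hy (abs_nonneg _)
  calc _ ≤ Real.exp (δ * |u|) * (2 / (Real.pi * Real.cos |y|) * Real.exp (-|u|)) := by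
        gcongr
    _ = 2 / (Real.pi * Real.cos |y|) * (Real.exp (δ * |u|) * Real.exp (-|u|)) := by ring
    _ = _ := by rw [← Real.exp_add]; ring_nf

/-- The decay `exp(-|u|)` beats `exp(δ u)`, uniformly in the height `y` because `cos y ≥ cos θ`. -/
theorem exists_integral_exp_mul_re_sechKernel_le (hδ0 : 0 ≤ δ) (hδ : δ < 1) {θ : ℝ}
    (hθ : θ < Real.pi / 2) :
    ∃ J : ℝ, ∀ y : ℝ, |y| ≤ θ → ∫ u : ℝ, Real.exp (δ * u) * (sechKernel ⟨u, y⟩).re ≤ J := by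
  refine ⟨∫ u : ℝ, 2 / (Real.pi * Real.cos θ) * Real.exp (-((1 - δ) * |u|)), fun y hy => ?_⟩
  refine integral_mono (integrable_exp_mul_re_sechKernel hδ0 hδ (hy.trans_lt hθ))
    ((integrable_exp_neg_mul_abs (sub_pos.2 hδ)).const_mul _) fun u => ?_
  have h1 := (Complex.re_le_norm _).trans (norm_sechKernel_le hθ (w := ⟨u, y⟩) hy)
  have h2 : δ * u ≤ δ * |u| := by gcongr; exact le_abs_self u
  have hc := cos_pos_of_lt hθ ((abs_nonneg _).trans hy)
  have h3 : 0 ≤ (sechKernel ⟨u, y⟩).re := re_sechKernel_nonneg (hy.trans_lt hθ)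
  calc _ ≤ Real.exp (δ * |u|) * (2 / (Real.pi * Real.cos θ) * Real.exp (-|u|)) := by
        gcongr
    _ = 2 / (Real.pi * Real.cos θ) * (Real.exp (δ * |u|) * Real.exp (-|u|)) := by ring
    _ = _ := by rw [← Real.exp_add]; ring_nf

end Conv

/-- Controlled growth of `ψ` at `-∞` in terms of `Φ` yields a holomorphic function on a closed
substrip whose real part lies between `ψ / 2` and a translate of `ψ + Φ + 1`. -/
theorem exists_strip_of_width_pi {ψ Φ : ℝ → ℝ} {A δ θ : ℝ} (hψ : Antitone ψ) (h0 : ∀ s, 0 ≤ ψ s)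
    (hΦ : ∀ s, 0 ≤ Φ s) (hδ0 : 0 < δ) (hδ : δ < 1) (hθ : θ < Real.pi / 2)
    (hA : ∀ x v, 0 ≤ v → ψ (x - v) ≤ A * (Φ x + 1) * Real.exp (δ * v)) :
    ∃ c : ℝ, 0 ≤ c ∧ DifferentiableOn ℂ (sechConv ψ) {w | |w.im| < θ} ∧
      ∀ w : ℂ, |w.im| < θ → ψ w.re / 2 ≤ (sechConv ψ w).re ∧
        (sechConv ψ w).re ≤ ψ (w.re - c) + Φ (w.re - c) + 1 := by
  have hA0 : 0 ≤ A := by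
    have h1 := (h0 _).trans (hA 0 0 le_rfl)
    simp only [mul_zero, Real.exp_zero, mul_one] at h1
    exact nonneg_of_mul_nonneg_left h1 (by linarith [hΦ 0])
  -- Taking `x = 0` in the growth hypothesis on the left, and monotonicity on the right, gives the
  -- bound that makes the convolution converge.
  have hD : ∀ s, ψ s ≤ A * (Φ 0 + 1) * Real.exp (δ * |s|) := by
    intro s
    rcases le_total s 0 with hs | hs
    · simpa [abs_of_nonpos hs] using hA 0 (-s) (by linarith)
    · calc ψ s ≤ ψ (0 - 0) := hψ (by simpa using hs)
        _ ≤ A * (Φ 0 + 1) * Real.exp (δ * 0) := hA 0 0 le_rfl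
        _ ≤ _ := by
          have := hΦ 0
          gcongr
          exact abs_nonneg s
  obtain ⟨J, hJ⟩ := exists_integral_exp_mul_re_sechKernel_le hδ0.le hδ hθ
  -- Comparing with the point `w.re - c` instead of `w.re` gains the factor `exp(-δ c)`, which
  -- absorbs `A * J`.
  obtain ⟨c, hc0, hc⟩ : ∃ c : ℝ, 0 ≤ c ∧ A * Real.exp (-(δ * c)) * J ≤ 1 := by
    have h1 : Tendsto (fun c : ℝ => A * Real.exp (-(δ * c)) * J) atTop (𝓝 (A * 0 * J)) :=
      ((Real.tendsto_exp_neg_atTop_nhds_zero.comp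
        (tendsto_id.const_mul_atTop hδ0)).const_mul A).mul_const J
    have h2 := (h1.eventually_lt_const (u := 1) (by simp)).and (eventually_ge_atTop 0)
    obtain ⟨c, hc1, hc2⟩ := h2.exists
    exact ⟨c, hc2, hc1.le⟩
  refine ⟨c, hc0, fun w hw => (differentiableAt_sechConv hψ h0 hδ hD
    (hw.trans hθ)).differentiableWithinAt, fun w hw => ?_⟩
  have hw' := hw.trans hθ
  refine ⟨half_le_re_sechConv hψ h0 hδ hD hw', ?_⟩
  obtain ⟨hi, he⟩ := re_sechConv hψ h0 hδ hD hw'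
  rw [he]
  set x := w.re - c with hx
  have hk := integrable_re_sechKernel hw'
  have hek := integrable_exp_mul_re_sechKernel hδ0.le hδ hw'
  have hΦx := hΦ x
  calc ∫ u : ℝ, ψ (w.re - u) * (sechKernel ⟨u, w.im⟩).re
      ≤ ∫ u : ℝ, (ψ x * (sechKernel ⟨u, w.im⟩).re + A * (Φ x + 1) * Real.exp (-(δ * c)) *
          (Real.exp (δ * u) * (sechKernel ⟨u, w.im⟩).re)) := by
        refine integral_mono hi ((hk.const_mul _).add (hek.const_mul _)) fun u => ?_
        have hn := re_sechKernel_nonneg (x := u) hw'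
        -- For `u ≤ c` monotonicity suffices; for `u ≥ c` the growth hypothesis is applied at `x =
        -- w.re - c` with `v = u - c`.
        have h3 : ψ (w.re - u) ≤ ψ x + A * (Φ x + 1) * Real.exp (-(δ * c)) * Real.exp (δ * u) := by
          rcases le_total u c with hu | hu
          · have h4 : ψ (w.re - u) ≤ ψ x := hψ (by linarith)
            have : 0 ≤ A * (Φ x + 1) * Real.exp (-(δ * c)) * Real.exp (δ * u) := by positivity
            linarith
          · have h4 := hA x (u - c) (by linarith)
            have h5 : x - (u - c) = w.re - u := by rw [hx]; ring
            have h6 : Real.exp (δ * (u - c)) = Real.exp (-(δ * c)) * Real.exp (δ * u) := by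
              rw [← Real.exp_add]; ring_nf
            rw [h5, h6, ← mul_assoc] at h4
            linarith [h0 x]
        calc _ ≤ _ := mul_le_mul_of_nonneg_right h3 hn
          _ = _ := by ring
    _ = ψ x + (Φ x + 1) * (A * Real.exp (-(δ * c)) *
          ∫ u : ℝ, Real.exp (δ * u) * (sechKernel ⟨u, w.im⟩).re) := by
        rw [integral_add (hk.const_mul _) (hek.const_mul _), integral_const_mul,
          integral_const_mul, integral_re_sechKernel hw']
        ring
    _ ≤ ψ x + (Φ x + 1) * (A * Real.exp (-(δ * c)) * J) := by
        gcongr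
        exact hJ _ hw.le
    _ ≤ ψ x + (Φ x + 1) * 1 := by gcongr
    _ = _ := by ring

/-- The version on strips of arbitrary width `γ π`. -/
theorem exists_strip {ψ Φ : ℝ → ℝ} {A r γ : ℝ} (hψ : Antitone ψ) (h0 : ∀ s, 0 ≤ ψ s)
    (hΦ : ∀ s, 0 ≤ Φ s) (hγ : 0 < γ) (hr : γ < r)
    (hA : ∀ x v, 0 ≤ v → ψ (x - v) ≤ A * (Φ x + 1) * Real.exp (v / r)) :
    ∃ (c : ℝ) (H : ℂ → ℂ), 0 ≤ c ∧ DifferentiableOn ℂ H {w | |w.im| < γ * Real.pi / 2} ∧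
      ∀ w : ℂ, |w.im| < γ * Real.pi / 2 → ψ w.re / 2 ≤ (H w).re ∧
        (H w).re ≤ ψ (w.re - c) + Φ (w.re - c) + 1 := by
  -- Dilation by `q` turns the half-width into `(γ/q)(π/2) < π/2` and the growth rate into `q/r <
  -- 1`; both inequalities need `γ < q < r`.
  obtain ⟨q, hq1, hq2⟩ := exists_between hr
  have hq : 0 < q := hγ.trans hq1
  have hr0 : 0 < r := hγ.trans hr
  have hp := Real.pi_pos
  obtain ⟨c, hc, hdiff, hb⟩ := exists_strip_of_width_pi (ψ := fun s => ψ (q * s))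
    (Φ := fun s => Φ (q * s)) (A := A) (δ := q / r) (θ := γ / q * (Real.pi / 2))
    (fun a b hab => hψ (mul_le_mul_of_nonneg_left hab hq.le)) (fun s => h0 _) (fun s => hΦ _)
    (by positivity) ((div_lt_one hr0).2 hq2)
    (mul_lt_of_lt_one_left (by positivity) ((div_lt_one hq).2 hq1))
    (fun x v hv => by
      have := hA (q * x) (q * v) (by positivity)
      rw [← mul_sub] at this
      rwa [div_mul_eq_mul_div])
  have hre : ∀ w : ℂ, (w / q).re = w.re / q := fun w => Complex.div_ofReal_re w q
  have him : ∀ w : ℂ, (w / q).im = w.im / q := fun w => Complex.div_ofReal_im w q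
  have hmem : ∀ w : ℂ, |w.im| < γ * Real.pi / 2 → |(w / q).im| < γ / q * (Real.pi / 2) := by
    intro w hw
    rw [him, abs_div, abs_of_pos hq, div_lt_iff₀ hq]
    calc _ < _ := hw
      _ = _ := by field_simp
  refine ⟨q * c, fun w => sechConv (fun s => ψ (q * s)) (w / q), by positivity, ?_, ?_⟩
  · exact hdiff.comp (by fun_prop) fun w hw => hmem w hw
  · intro w hw
    have := hb (w / q) (hmem w hw)
    rw [hre, mul_sub, mul_div_cancel₀ _ hq.ne'] at this
    exact this

/-! ### The infimum function of a sequence -/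

theorem bddBelow_range_mul_pow {M : ℕ → ℝ} (hM : ∀ p, 0 < M p) {t : ℝ} (ht : 0 ≤ t) :
    BddBelow (range fun k : ℕ => M k * t ^ k) :=
  ⟨0, by rintro _ ⟨k, rfl⟩; exact mul_nonneg (hM k).le (pow_nonneg ht k)⟩

theorem hFun_le {M : ℕ → ℝ} (hM : ∀ p, 0 < M p) {t : ℝ} (ht : 0 ≤ t) (k : ℕ) :
    hFun M t ≤ M k * t ^ k :=
  ciInf_le (bddBelow_range_mul_pow hM ht) k

theorem hFun_nonneg {M : ℕ → ℝ} (hM : ∀ p, 0 < M p) {t : ℝ} (ht : 0 ≤ t) : 0 ≤ hFun M t :=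
  le_ciInf fun k => mul_nonneg (hM k).le (pow_nonneg ht k)

theorem hFun_mono {M : ℕ → ℝ} (hM : ∀ p, 0 < M p) {s t : ℝ} (hs : 0 ≤ s) (hst : s ≤ t) :
    hFun M s ≤ hFun M t :=
  le_ciInf fun k => (hFun_le hM hs k).trans
    (mul_le_mul_of_nonneg_left (pow_le_pow_left₀ hs hst k) (hM k).le)

theorem hFun_le_one {M : ℕ → ℝ} (hM : ∀ p, 0 < M p) (h1 : M 0 = 1) {t : ℝ} (ht : 0 ≤ t) :
    hFun M t ≤ 1 := by
  simpa [h1] using hFun_le hM ht 0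

/-- Since `M k ^ (1/k)` eventually exceeds `1/t`, all but finitely many terms are at least 1, so the
infimum is bounded below by a positive minimum. -/
theorem hFun_pos {M : ℕ → ℝ} (hM : IsLC M) {t : ℝ} (ht : 0 < t) : 0 < hFun M t := by
  have h1 : ∀ᶠ k : ℕ in atTop, 1 ≤ M k * t ^ k := by
    filter_upwards [hM.tendsto_root.eventually_ge_atTop (1 / t), eventually_gt_atTop 0]
      with k hk hk0
    have h2 : (1 / t) ^ k ≤ M k := by
      calc (1 / t) ^ k ≤ (M k ^ (1 / (k : ℝ))) ^ k := by gcongr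
        _ = M k := by
          rw [one_div, Real.rpow_inv_natCast_pow (hM.pos k).le hk0.ne']
    rw [one_div, inv_pow] at h2
    calc (1 : ℝ) = (t ^ k)⁻¹ * t ^ k := (inv_mul_cancel₀ (pow_pos ht k).ne').symm
      _ ≤ _ := by gcongr
  have h3 : ∀ k, 0 < M k * t ^ k := fun k => mul_pos (hM.pos k) (pow_pos ht k)
  obtain ⟨K, hK⟩ := eventually_atTop.1 h1
  have hne : (Finset.range (K + 1)).Nonempty := ⟨0, by simp⟩
  obtain ⟨i, -, hi⟩ := Finset.exists_min_image (Finset.range (K + 1)) (fun k => M k * t ^ k) hne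
  refine lt_of_lt_of_le (lt_min (h3 i) one_pos) (le_ciInf fun k => ?_)
  rcases le_total K k with hk | hk
  · exact (min_le_right _ _).trans (hK k hk)
  · exact (min_le_left _ _).trans (hi k (by simp; omega))

/-- Moderate growth lets one absorb powers of `h_M` into dilations. -/
theorem ModerateGrowth.exists_hFun_le_rpow {M : ℕ → ℝ} (hmg : ModerateGrowth M)
    (hM : ∀ p, 0 < M p) (h1 : M 0 = 1) (b : ℝ) :
    ∃ A : ℝ, 0 < A ∧ ∀ t : ℝ, 0 ≤ t → hFun M t ≤ hFun M (A * t) ^ b := by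
  obtain ⟨C, hC1, hC⟩ := hmg
  have hC0 : 0 < C := one_pos.trans_le hC1
  -- By `(mg)`, the term of index `j + k` at `t` is at most the product of the terms of indices `j`
  -- and `k` at `C t`. The infimum is then taken over `k` and over `j` separately.
  have hsq : ∀ t : ℝ, 0 ≤ t → hFun M t ≤ hFun M (C * t) ^ 2 := by
    intro t ht
    have hCt : 0 ≤ C * t := by positivity
    have h0 := hFun_nonneg hM hCt
    have hjk : ∀ j k, hFun M t ≤ (M j * (C * t) ^ j) * (M k * (C * t) ^ k) := by
      intro j k
      calc hFun M t ≤ M (j + k) * t ^ (j + k) := hFun_le hM ht _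
        _ ≤ (C ^ (j + k) * M j * M k) * t ^ (j + k) := by gcongr; exact hC j k
        _ = _ := by simp only [mul_pow, pow_add]; ring
    have hj : ∀ j, hFun M t ≤ (M j * (C * t) ^ j) * hFun M (C * t) := by
      intro j
      have := mul_nonneg (hM j).le (pow_nonneg hCt j)
      rw [hFun, hFun, Real.mul_iInf_of_nonneg this]
      exact le_ciInf (hjk j)
    rw [sq]
    conv_rhs => arg 1; rw [hFun]
    rw [Real.iInf_mul_of_nonneg h0]
    exact le_ciInf hj
  have hpow : ∀ n : ℕ, ∀ t : ℝ, 0 ≤ t → hFun M t ≤ hFun M (C ^ n * t) ^ 2 ^ n := by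
    intro n
    induction n with
    | zero => intro t _; simp
    | succ n ih =>
      intro t ht
      have h2 := ih t ht
      have h3 := hsq (C ^ n * t) (by positivity)
      calc _ ≤ _ := h2
        _ ≤ (hFun M (C * (C ^ n * t)) ^ 2) ^ 2 ^ n :=
          pow_le_pow_left₀ (hFun_nonneg hM (by positivity)) h3 _
        _ = _ := by rw [← pow_mul, pow_succ' C, pow_succ' 2, mul_assoc]
  -- As `h_M ≤ 1`, passing from the exponent `2 ^ n` down to `b` only increases the power.
  obtain ⟨n, hn⟩ := pow_unbounded_of_one_lt b one_lt_two
  refine ⟨C ^ n, by positivity, fun t ht => (hpow n t ht).trans ?_⟩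
  have hA : 0 ≤ C ^ n * t := by positivity
  have h0 := hFun_nonneg hM hA
  have hle := hFun_le_one hM h1 hA
  have he : hFun M (C ^ n * t) ^ 2 ^ n = hFun M (C ^ n * t) ^ ((2 : ℝ) ^ n) := by
    rw [← Real.rpow_natCast]; norm_num
  rw [he]
  rcases h0.eq_or_lt with hz | hz
  · rw [← hz, Real.zero_rpow (by positivity)]
    exact Real.rpow_nonneg le_rfl _
  · exact Real.rpow_le_rpow_of_exponent_ge hz hle hn.le

/-! ### Derivatives on the surface and Cauchy estimates -/

theorem holomorphicOn_iterate_zderiv {G : LogSurface → ℂ} {S : Set LogSurface}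
    (hS : IsOpen {w : ℂ | (⟨w⟩ : LogSurface) ∈ S}) (hG : HolomorphicOn G S) (p : ℕ) :
    HolomorphicOn (zderiv^[p] G) S := by
  induction p with
  | zero => exact hG
  | succ p ih =>
    rw [Function.iterate_succ_apply']
    exact (Complex.differentiable_exp.comp differentiable_neg).differentiableOn.mul (ih.deriv hS)

/-- Read in the chart `u ↦ w + log (1 + u)` near `u = 0`, the derivatives on the surface are
multiples of ordinary derivatives. -/
theorem iteratedDeriv_chart {G : LogSurface → ℂ} {S : Set LogSurface}
    (hS : IsOpen {w : ℂ | (⟨w⟩ : LogSurface) ∈ S}) (hG : HolomorphicOn G S) (w : ℂ) {R : ℝ}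
    (hR : R ≤ 1) (hmem : ∀ u ∈ Metric.ball (0 : ℂ) R, (⟨w + Complex.log (1 + u)⟩ : LogSurface) ∈ S)
    (p : ℕ) : ∀ u ∈ Metric.ball (0 : ℂ) R,
      iteratedDeriv p (fun u => G ⟨w + Complex.log (1 + u)⟩) u
        = Complex.exp w ^ p * (zderiv^[p] G) ⟨w + Complex.log (1 + u)⟩ := by
  induction p with
  | zero => intro u _; simp
  | succ p ih =>
    intro u hu
    have hslit : 1 + u ∈ Complex.slitPlane := by
      refine Complex.mem_slitPlane_of_norm_lt_one ((mem_ball_zero_iff.1 hu).trans_le hR)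
    have h0 : 1 + u ≠ 0 := Complex.slitPlane_ne_zero hslit
    have hev : iteratedDeriv p (fun u => G ⟨w + Complex.log (1 + u)⟩) =ᶠ[𝓝 u]
        fun u => Complex.exp w ^ p * (zderiv^[p] G) ⟨w + Complex.log (1 + u)⟩ := by
      filter_upwards [Metric.isOpen_ball.mem_nhds hu] with v hv using ih v hv
    have hd1 : HasDerivAt (fun u => w + Complex.log (1 + u)) (1 / (1 + u)) u := by
      simpa using ((((hasDerivAt_id u).const_add 1).clog hslit).const_add w)
    have hd2 := ((holomorphicOn_iterate_zderiv hS hG p).differentiableAt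
      (hS.mem_nhds (hmem u hu))).hasDerivAt
    have hd3 := ((hd2.comp u hd1).const_mul (Complex.exp w ^ p)).deriv
    rw [iteratedDeriv_succ, hev.deriv_eq, Function.iterate_succ_apply', zderiv]
    refine hd3.trans ?_
    rw [neg_add, Complex.exp_add, Complex.exp_neg, Complex.exp_neg (Complex.log _),
      Complex.exp_log h0]
    have := Complex.exp_ne_zero w
    field_simp
    ring

/-- In the chart, `|u| ≤ R` is the disc of radius `R|z|` about `z = exp w`, so this is Cauchy's
estimate on that disc. -/
theorem norm_iterate_zderiv_le {G : LogSurface → ℂ} {S : Set LogSurface}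
    (hS : IsOpen {w : ℂ | (⟨w⟩ : LogSurface) ∈ S}) (hG : HolomorphicOn G S) (w : ℂ) {R B : ℝ}
    (hR0 : 0 < R) (hR : R < 1)
    (hmem : ∀ u ∈ Metric.closedBall (0 : ℂ) R, (⟨w + Complex.log (1 + u)⟩ : LogSurface) ∈ S)
    (hB : ∀ u ∈ Metric.closedBall (0 : ℂ) R, ‖G ⟨w + Complex.log (1 + u)⟩‖ ≤ B) (p : ℕ) :
    ‖(zderiv^[p] G) ⟨w⟩‖ ≤ p.factorial * B / (R * Real.exp w.re) ^ p := by
  have hdiff : DifferentiableOn ℂ (fun u => G ⟨w + Complex.log (1 + u)⟩)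
      (Metric.closedBall (0 : ℂ) R) := by
    refine DifferentiableOn.comp (g := fun v : ℂ => G ⟨v⟩) hG (fun u hu => ?_) hmem
    have hslit : 1 + u ∈ Complex.slitPlane :=
      Complex.mem_slitPlane_of_norm_lt_one ((mem_closedBall_zero_iff.1 hu).trans_lt hR)
    exact (((differentiableAt_id.const_add 1).clog hslit).const_add w).differentiableWithinAt
  have h1 := Complex.norm_iteratedDeriv_le_of_forall_mem_sphere_norm_le p hR0
    (hdiff.diffContOnCl_ball subset_rfl) fun u hu => hB u (Metric.sphere_subset_closedBall hu)
  rw [iteratedDeriv_chart hS hG w hR.le (fun u hu => hmem u (Metric.ball_subset_closedBall hu)) p 0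
    (Metric.mem_ball_self hR0)] at h1
  simp only [add_zero, Complex.log_one, norm_mul, norm_pow, Complex.norm_exp] at h1
  have he := pow_pos (Real.exp_pos w.re) p
  have hRp := pow_pos hR0 p
  rw [mul_pow, le_div_iff₀ (by positivity)]
  rw [le_div_iff₀ hRp] at h1
  linarith

theorem isOpen_sector (γ : ℝ) : IsOpen {w : ℂ | (⟨w⟩ : LogSurface) ∈ sector γ} :=
  isOpen_lt Complex.continuous_im.abs continuous_const

theorem LogSurface.modulus_pos (z : LogSurface) : 0 < z.modulus := Real.exp_pos _

/-- A bound by `h_L` on a larger sector controls all derivatives. -/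
theorem exists_norm_iterate_zderiv_le {L : ℕ → ℝ} (hL : ∀ p, 0 < L p) {A γ γ' : ℝ} (hA : 0 < A)
    (hγ : γ < γ') {G : LogSurface → ℂ} (hG : HolomorphicOn G (sector γ'))
    (hb : ∀ ξ ∈ sector γ', ‖G ξ‖ ≤ hFun L (A * ξ.modulus)) :
    ∃ R : ℝ, 0 < R ∧ ∀ p q : ℕ, ∀ ξ ∈ sector γ,
      ‖(zderiv^[p] G) ξ‖ ≤ p.factorial * (L q * (2 * A * ξ.modulus) ^ q) / (R * ξ.modulus) ^ p := by
  have hcont : ContinuousAt (fun u : ℂ => |(Complex.log (1 + u)).im|) 0 := by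
    refine continuous_abs.continuousAt.comp (Complex.continuous_im.continuousAt.comp ?_)
    exact ((continuousAt_const.add continuousAt_id).clog (by simp))
  -- For small `u`, multiplication by `1 + u` turns the argument by less than the gap between the
  -- two sectors, uniformly in `ξ`.
  have hev : ∀ᶠ u : ℂ in 𝓝 0, |(Complex.log (1 + u)).im| < (γ' - γ) * Real.pi / 2 := by
    refine hcont.eventually_lt_const ?_
    have := sub_pos.2 hγ
    have := Real.pi_pos
    simp only [add_zero, Complex.log_one, Complex.zero_im, abs_zero]
    positivity
  obtain ⟨ε, hε0, hε⟩ := Metric.eventually_nhds_iff_ball.1 hev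
  have hR0 : 0 < min (ε / 2) (1 / 2) := by positivity
  refine ⟨min (ε / 2) (1 / 2), hR0, fun p q ξ hξ => ?_⟩
  have hR1 : min (ε / 2) (1 / 2) < 1 := (min_le_right _ _).trans_lt (by norm_num)
  have hmem : ∀ u ∈ Metric.closedBall (0 : ℂ) (min (ε / 2) (1 / 2)),
      (⟨ξ.log + Complex.log (1 + u)⟩ : LogSurface) ∈ sector γ' := by
    intro u hu
    have h1 := hε u (Metric.closedBall_subset_ball
      ((min_le_left _ _).trans_lt (half_lt_self hε0)) hu)
    have h2 : |ξ.log.im| < γ * Real.pi / 2 := hξ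
    change |(ξ.log + Complex.log (1 + u)).im| < γ' * Real.pi / 2
    rw [Complex.add_im]
    refine (abs_add_le _ _).trans_lt ((add_lt_add h2 h1).trans_eq ?_)
    ring
  refine norm_iterate_zderiv_le (isOpen_sector γ') hG ξ.log hR0 hR1 hmem (fun u hu => ?_) p
  have hslit : 1 + u ∈ Complex.slitPlane :=
    Complex.mem_slitPlane_of_norm_lt_one ((mem_closedBall_zero_iff.1 hu).trans_lt hR1)
  have hm := ξ.modulus_pos
  have hle : (⟨ξ.log + Complex.log (1 + u)⟩ : LogSurface).modulus ≤ 2 * ξ.modulus := by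
    have h1 : ‖1 + u‖ ≤ 2 := by
      have h2 := norm_add_le 1 u
      have h3 := mem_closedBall_zero_iff.1 hu
      rw [norm_one] at h2
      linarith
    rw [LogSurface.modulus, Complex.add_re, Real.exp_add, Complex.log_re,
      Real.exp_log (norm_pos_iff.2 (Complex.slitPlane_ne_zero hslit)), mul_comm]
    exact mul_le_mul_of_nonneg_right h1 hm.le
  have hm' := (⟨ξ.log + Complex.log (1 + u)⟩ : LogSurface).modulus_pos
  refine (hb _ (hmem u hu)).trans ((hFun_le hL (by positivity) q).trans ?_)
  refine mul_le_mul_of_nonneg_left (pow_le_pow_left₀ (by positivity) ?_ q) (hL q).le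
  linarith [mul_le_mul_of_nonneg_left hle hA.le]

/-- In the preceding estimate `q` is free: `q = p` cancels every power of `|ξ|` and gives the class,
while `q = p + 1` leaves one factor `|ξ|` and gives flatness. -/
theorem mem_ultraClass_and_flat {L : ℕ → ℝ} (hL : ∀ p, 0 < L p) {A γ γ' : ℝ} (hA : 0 < A)
    (hγ : γ < γ') {G : LogSurface → ℂ} (hG : HolomorphicOn G (sector γ'))
    (hb : ∀ ξ ∈ sector γ', ‖G ξ‖ ≤ hFun L (A * ξ.modulus)) :
    G ∈ ultraClass (hat L) (sector γ) ∧ Flat G (sector γ) := by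
  obtain ⟨R, hR, hd⟩ := exists_norm_iterate_zderiv_le hL hA hγ hG hb
  constructor
  · refine mem_iUnion₂.2 ⟨2 * A / R, mem_Ioi.2 (by positivity), ?_, 1, fun ξ hξ p => ?_⟩
    · refine DifferentiableOn.mono hG fun w hw => ?_
      have h2 : |w.im| < γ * Real.pi / 2 := hw
      change |w.im| < γ' * Real.pi / 2
      refine h2.trans ?_
      have := Real.pi_pos
      gcongr
    · have hm := ξ.modulus_pos
      have := hL p
      have hh : 0 < (2 * A / R) ^ p * hat L p := by
        unfold hat
        positivity
      rw [div_le_one hh]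
      refine (hd p p ξ hξ).trans_eq ?_
      rw [hat, mul_pow (2 * A), mul_pow R, div_pow]
      field_simp
  · intro p
    have hlim : Tendsto (fun ξ : LogSurface =>
        p.factorial * (L (p + 1) * (2 * A) ^ (p + 1)) / R ^ p * ξ.modulus)
        (comap LogSurface.modulus (𝓝 0) ⊓ 𝓟 (sector γ)) (𝓝 0) := by
      have : Tendsto LogSurface.modulus (comap LogSurface.modulus (𝓝 0) ⊓ 𝓟 (sector γ)) (𝓝 0) :=
        tendsto_comap.mono_left inf_le_left
      simpa using this.const_mul (p.factorial * (L (p + 1) * (2 * A) ^ (p + 1)) / R ^ p)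
    refine squeeze_zero_norm' ?_ hlim
    filter_upwards [mem_inf_of_right (mem_principal_self (sector γ))] with ξ hξ
    have hm := ξ.modulus_pos
    refine (hd p (p + 1) ξ hξ).trans_eq ?_
    rw [mul_pow (2 * A), mul_pow R, pow_succ ξ.modulus]
    field_simp

/-! ### Mixed growth condition for weight sequences -/

theorem IsLC.quot_pos {M : ℕ → ℝ} (hM : IsLC M) (p : ℕ) : 0 < quot M p := by
  cases p with
  | zero => exact one_pos
  | succ p => exact div_pos (hM.pos _) (hM.pos _)

theorem IsLC.log_eq_sum {M : ℕ → ℝ} (hM : IsLC M) (k : ℕ) :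
    Real.log (M k) = ∑ j ∈ Finset.range k, Real.log (quot M (j + 1)) := by
  induction k with
  | zero => simp [hM.zero_eq_one]
  | succ k ih =>
    rw [Finset.sum_range_succ, ← ih, quot, Real.log_div (hM.pos _).ne' (hM.pos _).ne']
    ring

/-- If no quotient exceeded `τ`, then `M k ≤ τ ^ k`, contradicting the divergence of the roots. -/
theorem IsLC.exists_lt_quot {M : ℕ → ℝ} (hM : IsLC M) {τ : ℝ} (hτ : 0 < τ) :
    ∃ m : ℕ, (∀ j < m, quot M (j + 1) ≤ τ) ∧ τ < quot M (m + 1) := by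
  have hex : ∃ m : ℕ, τ < quot M (m + 1) := by
    by_contra! hcon
    have hle : ∀ k, M k ≤ τ ^ k := by
      intro k
      induction k with
      | zero => simp [hM.zero_eq_one]
      | succ k ih =>
        have h1 := hcon k
        rw [quot, div_le_iff₀ (hM.pos k)] at h1
        rw [pow_succ']
        exact h1.trans (mul_le_mul_of_nonneg_left ih hτ.le)
    obtain ⟨k, hk, hk0⟩ :=
      ((hM.tendsto_root.eventually_gt_atTop τ).and (eventually_gt_atTop 0)).exists
    have h2 : (M k ^ (1 / (k : ℝ))) ^ k = M k := by
      rw [one_div, Real.rpow_inv_natCast_pow (hM.pos k).le hk0.ne']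
    have h3 : τ ^ k < (M k ^ (1 / (k : ℝ))) ^ k := pow_lt_pow_left₀ hk hτ.le hk0.ne'
    exact absurd (hle k) (by rw [h2] at h3; exact not_le.2 h3)
  classical
  exact ⟨Nat.find hex, fun j hj => not_lt.1 (Nat.find_min hex hj), Nat.find_spec hex⟩

theorem log_mul_exp_pow {M : ℕ → ℝ} (hM : IsLC M) (y : ℝ) (k : ℕ) :
    Real.log (M k * Real.exp y ^ k) = ∑ j ∈ Finset.range k, (Real.log (quot M (j + 1)) + y) := by
  rw [Real.log_mul (hM.pos k).ne' (pow_pos (Real.exp_pos y) k).ne', Real.log_pow, Real.log_exp,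
    hM.log_eq_sum, Finset.sum_add_distrib]
  simp

theorem log_hFun_le {M : ℕ → ℝ} (hM : IsLC M) (y : ℝ) (k : ℕ) :
    Real.log (hFun M (Real.exp y)) ≤ ∑ j ∈ Finset.range k, (Real.log (quot M (j + 1)) + y) := by
  rw [← log_mul_exp_pow hM]
  exact Real.log_le_log (hFun_pos hM (Real.exp_pos y)) (hFun_le hM.pos (Real.exp_pos y).le k)

/-- `-log h_N(e^{x-v})` is the supremum over `k` of sums of `v - x - log ν_{j+1}`. The sum is cut at
the first `m` with `μ_{m+1} > e^{-x}`: the head is compared with `M`, the tail with the series in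
the condition. -/
theorem SeqGammaCond.exists_neg_log_hFun_le {M N : ℕ → ℝ} (hM : IsLC M) (hN : IsLC N)
    (hMN : ∀ p, quot M p ≤ quot N p) {r : ℝ} (hr : 0 < r) (h : SeqGammaCond M N r) :
    ∃ A : ℝ, ∀ x v : ℝ, 0 ≤ v → -Real.log (hFun N (Real.exp (x - v)))
      ≤ A * (-Real.log (hFun M (Real.exp (x - 1))) + 1) * Real.exp (v / r) := by
  obtain ⟨hsum, C, hC⟩ := h
  have hterm : ∀ k, 0 ≤ (1 / quot N k) ^ (1 / r) := fun k =>
    Real.rpow_nonneg (one_div_nonneg.2 (hN.quot_pos k).le) _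
  have hC0 : 0 ≤ C := by
    refine le_trans ?_ (hC 1 le_rfl)
    have := hM.quot_pos 1
    have : 0 ≤ ∑' k : ℕ, (1 / quot N (1 + k)) ^ (1 / r) := tsum_nonneg fun k => hterm _
    positivity
  refine ⟨1 + r + r * C, fun x v hv => ?_⟩
  obtain ⟨m, hm1, hm2⟩ := hM.exists_lt_quot (Real.exp_pos (-x))
  set Φ := -Real.log (hFun M (Real.exp (x - 1))) with hΦ
  -- The shift by 1 in `Φ` serves here: each of the first `m` summands of `log (M m * exp (x - 1) ^
  -- m)` is at most `-1`.
  have hΦm : (m : ℝ) ≤ Φ := by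
    have h1 := log_hFun_le hM (x - 1) m
    have h2 : ∑ j ∈ Finset.range m, (Real.log (quot M (j + 1)) + (x - 1))
        ≤ ∑ j ∈ Finset.range m, (-1 : ℝ) := by
      refine Finset.sum_le_sum fun j hj => ?_
      have := Real.log_le_log (hM.quot_pos _) (hm1 j (Finset.mem_range.1 hj))
      rw [Real.log_exp] at this
      linarith
    simp only [Finset.sum_const, Finset.card_range, nsmul_eq_mul, mul_neg, mul_one] at h2
    linarith
  have hΦx : -Real.log (hFun M (Real.exp x)) ≤ Φ := by
    have h1 := hFun_mono hM.pos (Real.exp_pos (x - 1)).le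
      (Real.exp_le_exp.2 (by linarith : x - 1 ≤ x))
    have := Real.log_le_log (hFun_pos hM (Real.exp_pos _)) h1
    linarith
  have hm0 : (0 : ℝ) ≤ m := Nat.cast_nonneg m
  have htail : Real.exp (-x / r) * ∑' k : ℕ, (1 / quot N (m + 1 + k)) ^ (1 / r) ≤ C * (m + 1) := by
    have h1 := hC (m + 1) (by omega)
    have h2 : Real.exp (-x / r) ≤ quot M (m + 1) ^ (1 / r) := by
      have : Real.exp (-x / r) = Real.exp (-x) ^ (1 / r) := by
        rw [← Real.exp_mul]; ring_nf
      rw [this]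
      exact Real.rpow_le_rpow (Real.exp_pos _).le hm2.le (by positivity)
    have h3 : 0 ≤ ∑' k : ℕ, (1 / quot N (m + 1 + k)) ^ (1 / r) := tsum_nonneg fun k => hterm _
    rw [div_mul_eq_mul_div, div_le_iff₀ (by positivity)] at h1
    push_cast at h1
    exact (mul_le_mul_of_nonneg_right h2 h3).trans h1
  set E := Real.exp (v / r) with hE
  have hE1 : 1 ≤ E := Real.one_le_exp (by positivity)
  have hvE : v ≤ r * E := by
    have : v / r ≤ E := by linarith [Real.add_one_le_exp (v / r)]
    rwa [div_le_iff₀' hr] at this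
  have hmain : ∀ k, -(Φ + v * m + r * E * (C * (m + 1)))
      ≤ ∑ j ∈ Finset.range k, (Real.log (quot N (j + 1)) + (x - v)) := by
    intro k
    have hhead : ∀ n ≤ m, -(Φ + v * m)
        ≤ ∑ j ∈ Finset.range n, (Real.log (quot N (j + 1)) + (x - v)) := by
      intro n hn
      have h1 := log_hFun_le hM x n
      have h2 : ∑ j ∈ Finset.range n, (Real.log (quot M (j + 1)) + x)
          ≤ ∑ j ∈ Finset.range n, (Real.log (quot N (j + 1)) + (x - v)) + v * n := by
        have : v * n = ∑ j ∈ Finset.range n, v := by simp [mul_comm]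
        rw [this, ← Finset.sum_add_distrib]
        refine Finset.sum_le_sum fun j _ => ?_
        have := Real.log_le_log (hM.quot_pos _) (hMN (j + 1))
        linarith
      have h3 : v * n ≤ v * m := by gcongr
      linarith
    have hpos : 0 ≤ r * E * (C * (m + 1)) := by positivity
    rcases le_total k m with hk | hk
    · linarith [hhead k hk]
    · rw [← Finset.sum_range_add_sum_Ico _ hk, Finset.sum_Ico_eq_sum_range]
      have h4 : -(r * E * (C * (m + 1)))
          ≤ ∑ i ∈ Finset.range (k - m), (Real.log (quot N (m + i + 1)) + (x - v)) := by
        -- This is `log y ≤ r y^{1/r}`, a form of `t ≤ e^t`, with `y = e^{v-x}/ν`.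
        have h5 : ∀ i, -(Real.log (quot N (m + i + 1)) + (x - v))
            ≤ r * E * Real.exp (-x / r) * (1 / quot N (m + 1 + i)) ^ (1 / r) := by
          intro i
          have hq := hN.quot_pos (m + 1 + i)
          rw [show m + i + 1 = m + 1 + i by omega, one_div (quot N _),
            Real.rpow_def_of_pos (inv_pos.2 hq), Real.log_inv, mul_assoc r, mul_assoc r, hE,
            ← Real.exp_add, ← Real.exp_add, ← div_le_iff₀' hr]
          refine le_trans (le_of_eq ?_) ((le_add_of_nonneg_right zero_le_one).trans
            (Real.add_one_le_exp _))
          field_simp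
          ring
        have h6 : ∑ i ∈ Finset.range (k - m), -(Real.log (quot N (m + i + 1)) + (x - v))
            ≤ r * E * (C * (m + 1)) := by
          calc _ ≤ ∑ i ∈ Finset.range (k - m),
                r * E * Real.exp (-x / r) * (1 / quot N (m + 1 + i)) ^ (1 / r) :=
                Finset.sum_le_sum fun i _ => h5 i
            _ = r * E * (Real.exp (-x / r) *
                ∑ i ∈ Finset.range (k - m), (1 / quot N (m + 1 + i)) ^ (1 / r)) := by
                rw [← Finset.mul_sum]; ring
            _ ≤ r * E * (Real.exp (-x / r) *
                ∑' i : ℕ, (1 / quot N (m + 1 + i)) ^ (1 / r)) := by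
                gcongr
                refine Summable.sum_le_tsum _ (fun i _ => hterm _) ?_
                have := (summable_nat_add_iff (m + 1)).2 hsum
                simpa only [add_comm] using this
            _ ≤ _ := by gcongr
        rw [Finset.sum_neg_distrib] at h6
        linarith
      linarith [hhead m le_rfl]
  have hfin : Φ + v * m + r * E * (C * (m + 1)) ≤ (1 + r + r * C) * (Φ + 1) * E := by
    have hΦ0 : 0 ≤ Φ := hm0.trans hΦm
    have h1 : Φ ≤ (Φ + 1) * E := by nlinarith
    have h2 : v * m ≤ r * ((Φ + 1) * E) := by
      calc v * m ≤ (r * E) * (Φ + 1) := by gcongr; linarith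
        _ = _ := by ring
    have h3 : r * E * (C * (m + 1)) ≤ r * C * ((Φ + 1) * E) := by
      calc r * E * (C * (m + 1)) ≤ r * E * (C * (Φ + 1)) := by gcongr
        _ = _ := by ring
    linarith
  rw [neg_le]
  refine le_trans (neg_le_neg hfin) ?_
  rw [Real.le_log_iff_exp_le (hFun_pos hN (Real.exp_pos _))]
  refine le_ciInf fun k => ?_
  rw [← Real.le_log_iff_exp_le (mul_pos (hN.pos k) (pow_pos (Real.exp_pos _) k)),
    log_mul_exp_pow hN]
  exact hmain k

/-! ### Mixed growth condition for weight functions -/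

/-- Only the part `u > U` of the integral is kept; there `ω(tu) ≥ ω(tU)`, and `u^{-1-1/r}`
integrates to `r U^{-1/r}`. -/
theorem FunGammaCond.exists_le_rpow {σ ω : ℝ → ℝ} (hσ : IsWeightFunction σ)
    (hω : IsWeightFunction ω) {r : ℝ} (hr : 0 < r) (h : FunGammaCond σ ω r) :
    ∃ A : ℝ, ∀ t U : ℝ, 0 ≤ t → 1 ≤ U → ω (t * U) ≤ A * (σ t + 1) * U ^ (1 / r) := by
  obtain ⟨C, hC, hle⟩ := h
  refine ⟨C / r, fun t U ht hU => ?_⟩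
  have hU0 : 0 < U := one_pos.trans_le hU
  have h1r : 0 < 1 / r := by positivity
  have hint : ∫⁻ u in Ioi U, ENNReal.ofReal (ω (t * U) * u ^ (-(1 + 1 / r)))
      = ENNReal.ofReal (ω (t * U) * (r * U ^ (-(1 / r)))) := by
    have hi := (integrableOn_Ioi_rpow_of_lt (a := -(1 + 1 / r)) (by linarith) hU0).const_mul
      (ω (t * U))
    rw [← MeasureTheory.ofReal_integral_eq_lintegral_ofReal hi, MeasureTheory.integral_const_mul,
      integral_Ioi_rpow_of_lt (by linarith) hU0]
    · congr 2
      rw [show -(1 + 1 / r) + 1 = -(1 / r) by ring]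
      field_simp
    · filter_upwards [MeasureTheory.ae_restrict_mem measurableSet_Ioi] with u hu
      have : 0 < u := hU0.trans hu
      exact mul_nonneg (hω.nonneg _ (by positivity)) (Real.rpow_nonneg this.le _)
  have hmono : ∫⁻ u in Ioi U, ENNReal.ofReal (ω (t * U) * u ^ (-(1 + 1 / r)))
      ≤ ENNReal.ofReal (C * σ t + C) := by
    refine le_trans ?_ (hle t ht)
    refine le_trans ?_ (MeasureTheory.lintegral_mono_set (Ioi_subset_Ioi hU))
    refine MeasureTheory.setLIntegral_mono' measurableSet_Ioi fun u hu => ?_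
    have hu0 : 0 < u := hU0.trans hu
    rw [Real.rpow_neg hu0.le, ← div_eq_mul_inv]
    refine ENNReal.ofReal_le_ofReal ?_
    gcongr
    exact hω.monotoneOn (mem_Ici.2 (by positivity)) (mem_Ici.2 (by positivity))
      (mul_le_mul_of_nonneg_left (mem_Ioi.1 hu).le ht)
  have hσt := hσ.nonneg t ht
  rw [hint, ENNReal.ofReal_le_ofReal_iff (by positivity), Real.rpow_neg hU0.le] at hmono
  have hUr : 0 < U ^ (1 / r) := Real.rpow_pos_of_pos hU0 _
  have h2 : ω (t * U) * (r * (U ^ (1 / r))⁻¹) = ω (t * U) * r / U ^ (1 / r) := by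
    rw [div_eq_mul_inv]; ring
  rw [h2, div_le_iff₀ hUr] at hmono
  rw [← mul_le_mul_iff_left₀ hr]
  refine hmono.trans_eq ?_
  field_simp

/-! ### The weight matrix of a weight function -/

theorem Omega3.exists_mul_le {ω : ℝ → ℝ} (hω : IsWeightFunction ω) (h3 : Omega3 ω) (c : ℝ) :
    ∃ Y : ℝ, 0 ≤ Y ∧ ∀ y, Y ≤ y → c * y ≤ phi ω y := by
  have h1 := h3.def (c := 1 / (|c| + 1)) (by positivity)
  have h2 := Real.tendsto_exp_atTop.eventually h1
  obtain ⟨Y, hY⟩ := eventually_atTop.1 h2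
  refine ⟨max Y 0, le_max_right _ _, fun y hy => ?_⟩
  have hy0 : 0 ≤ y := (le_max_right _ _).trans hy
  have h4 := hY y ((le_max_left _ _).trans hy)
  have h5 : 0 ≤ ω (Real.exp y) := hω.nonneg _ (Real.exp_pos y).le
  rw [Real.log_exp, Real.norm_eq_abs, Real.norm_eq_abs, abs_of_nonneg hy0, abs_of_nonneg h5,
    one_div, ← div_eq_inv_mul, le_div_iff₀ (by positivity)] at h4
  unfold phi
  nlinarith [le_abs_self c]

theorem bddAbove_conjPhi {ω : ℝ → ℝ} (hω : IsWeightFunction ω) (h3 : Omega3 ω) (x : ℝ) :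
    BddAbove ((fun y : ℝ => x * y - phi ω y) '' Ici 0) := by
  obtain ⟨Y, hY0, hY⟩ := h3.exists_mul_le hω x
  refine ⟨|x| * Y, ?_⟩
  rintro _ ⟨y, hy, rfl⟩
  have hy0 : 0 ≤ y := hy
  have h5 : 0 ≤ phi ω y := hω.nonneg _ (Real.exp_pos y).le
  change x * y - phi ω y ≤ _
  rcases le_total Y y with h | h
  · have := hY y h
    have : 0 ≤ |x| * Y := by positivity
    linarith
  · have : x * y ≤ |x| * Y := (mul_le_mul_of_nonneg_right (le_abs_self x) hy0).trans
      (mul_le_mul_of_nonneg_left h (abs_nonneg x))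
    linarith

theorem le_conjPhi {ω : ℝ → ℝ} (hω : IsWeightFunction ω) (h3 : Omega3 ω) (x : ℝ) {y : ℝ}
    (hy : 0 ≤ y) : x * y - phi ω y ≤ conjPhi ω x :=
  le_csSup (bddAbove_conjPhi hω h3 x) ⟨y, hy, rfl⟩

theorem conjPhi_le {ω : ℝ → ℝ} {x B : ℝ} (h : ∀ y, 0 ≤ y → x * y - phi ω y ≤ B) :
    conjPhi ω x ≤ B :=
  csSup_le ⟨_, 0, mem_Ici.2 le_rfl, rfl⟩ (by rintro _ ⟨y, hy, rfl⟩; exact h y hy)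

theorem weightMatrix_pos (ω : ℝ → ℝ) (l : ℝ) (j : ℕ) : 0 < weightMatrix ω l j := Real.exp_pos _

theorem weightMatrix_mul_pow (ω : ℝ → ℝ) (l : ℝ) {t : ℝ} (ht : 0 < t) (k : ℕ) :
    weightMatrix ω l k * t ^ k = Real.exp (1 / l * conjPhi ω (l * k) + k * Real.log t) := by
  rw [Real.exp_add, weightMatrix, Real.exp_nat_mul, Real.exp_log ht]

/-- Young's inequality at `y = -log t`. When `t > 1` this `y` is not admissible in the conjugate;
there `ω(1/t) = 0` by normalization, and `y = 0` suffices. -/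
theorem exp_neg_le_hFun_weightMatrix {ω : ℝ → ℝ} (hω : IsWeightFunction ω) (hn : Normalized ω)
    (h3 : Omega3 ω) {l : ℝ} (hl : 0 < l) {t : ℝ} (ht : 0 < t) :
    Real.exp (-(1 / l) * ω (1 / t)) ≤ hFun (weightMatrix ω l) t := by
  refine le_ciInf fun k => ?_
  rw [weightMatrix_mul_pow ω l ht, Real.exp_le_exp]
  have hk : (0 : ℝ) ≤ k := Nat.cast_nonneg k
  have key : l * k * -Real.log t - ω (1 / t) ≤ conjPhi ω (l * k) := by
    rcases le_total t 1 with h1 | h1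
    · have h2 := le_conjPhi hω h3 (l * k) (neg_nonneg.2 (Real.log_nonpos ht.le h1))
      have h4 : phi ω (-Real.log t) = ω (1 / t) := by
        rw [phi, Real.exp_neg, Real.exp_log ht, one_div]
      rwa [h4] at h2
    · have h2 := le_conjPhi hω h3 (l * k) le_rfl
      have h4 : phi ω 0 = 0 := by
        rw [phi, Real.exp_zero]; exact hn 1 ⟨zero_le_one, le_rfl⟩
      have h5 : ω (1 / t) = 0 := hn _ ⟨by positivity, (div_le_one ht).2 h1⟩
      have h6 : 0 ≤ l * k * Real.log t := mul_nonneg (by positivity) (Real.log_nonneg h1)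
      rw [h4] at h2
      rw [h5]
      linarith
  have h7 := mul_le_mul_of_nonneg_left key (one_div_nonneg.2 hl.le)
  have h8 : 1 / l * (l * k * -Real.log t - ω (1 / t))
      = -(k * Real.log t) - 1 / l * ω (1 / t) := by
    field_simp
  linarith

theorem exists_subgradient {f : ℝ → ℝ} (hf : ConvexOn ℝ univ f) (y : ℝ) :
    ∃ s : ℝ, ∀ v, f y + s * (v - y) ≤ f v := by
  have hi : ∀ z : ℝ, z ∈ interior (univ : Set ℝ) := fun z => by simp
  refine ⟨derivWithin f (Ioi y) y, fun v => ?_⟩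
  rcases lt_trichotomy v y with h | rfl | h
  · have h1 := (hf.slope_le_leftDeriv_of_mem_interior (mem_univ v) (hi y) h).trans
      (hf.leftDeriv_le_rightDeriv_of_mem_interior (hi y))
    rw [slope_def_field, div_le_iff₀ (by linarith)] at h1
    linarith
  · simp
  · have h1 := hf.rightDeriv_le_slope_of_mem_interior (hi y) (mem_univ v) h
    rw [slope_def_field, le_div_iff₀ (by linarith)] at h1
    linarith

/-- At the real index `s/l`, with `s` a slope of `φ_σ` at `y = -log t`, duality would be exact.
Rounding down to an integer costs at most a factor 2 in the exponent, which `l = 1/(2b)`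
compensates. -/
theorem IsW0.exists_hFun_weightMatrix_le {σ : ℝ → ℝ} (hσ : IsW0 σ) {b : ℝ} (hb : 0 < b) :
    ∃ l D : ℝ, 0 < l ∧ 0 < D ∧ ∀ t : ℝ, 0 < t →
      D * hFun (weightMatrix σ l) t ≤ Real.exp (-b * σ (1 / t)) := by
  have hl : 0 < 1 / (2 * b) := by positivity
  obtain ⟨Y, hY0, hY⟩ := hσ.omega3.exists_mul_le hσ.weight (1 / (2 * b) + 1)
  set l := 1 / (2 * b) with hldef
  have hphi0 : phi σ 0 = 0 := by
    rw [phi, Real.exp_zero]; exact hσ.normalized 1 ⟨zero_le_one, le_rfl⟩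
  have hphin : ∀ y, 0 ≤ phi σ y := fun y => hσ.weight.nonneg _ (Real.exp_pos y).le
  refine ⟨l, Real.exp (-b * (l * Y)), hl, Real.exp_pos _, fun t ht => ?_⟩
  have hh0 : 0 ≤ hFun (weightMatrix σ l) t := hFun_nonneg (weightMatrix_pos σ l) ht.le
  have hDle : Real.exp (-b * (l * Y)) ≤ 1 := by
    rw [Real.exp_le_one_iff]
    have : 0 ≤ b * (l * Y) := by positivity
    linarith
  have hh1 : hFun (weightMatrix σ l) t ≤ 1 := by
    refine (hFun_le (weightMatrix_pos σ l) ht.le 0).trans ?_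
    rw [weightMatrix_mul_pow σ l ht, Real.exp_le_one_iff]
    have : conjPhi σ (l * (0 : ℕ)) ≤ 0 := conjPhi_le fun y _ => by
      simpa using hphin y
    have := mul_nonpos_of_nonneg_of_nonpos (one_div_nonneg.2 hl.le) this
    simpa using this
  set y := -Real.log t with hy
  have hphiy : phi σ y = σ (1 / t) := by
    rw [phi, hy, Real.exp_neg, Real.exp_log ht, one_div]
  rw [← hphiy]
  -- The constant `D = exp(-b l Y)` covers the bounded range of `φ_σ`, using only `h ≤ 1`.
  have hsmall : phi σ y ≤ l * Y →
      Real.exp (-b * (l * Y)) * hFun (weightMatrix σ l) t ≤ Real.exp (-b * phi σ y) := by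
    intro h
    refine (mul_le_of_le_one_right (Real.exp_pos _).le hh1).trans (Real.exp_le_exp.2 ?_)
    nlinarith
  rcases le_or_gt y 0 with hy0 | hy0
  · refine hsmall ?_
    have : phi σ y = 0 := hσ.normalized _ ⟨(Real.exp_pos y).le, Real.exp_le_one_iff.2 hy0⟩
    rw [this]
    positivity
  obtain ⟨s, hs⟩ := exists_subgradient hσ.omega4 y
  -- If `s < l` the rounded index would be 0. But then `φ_σ(y) ≤ l y`, and the choice of `Y` with
  -- slope `l + 1` forces `y < Y`.
  rcases lt_or_ge s l with hsl | hsl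
  · refine hsmall ?_
    have h1 := hs 0
    rw [hphi0] at h1
    have h2 : phi σ y ≤ l * y := by nlinarith
    rcases le_or_gt Y y with h | h
    · have := hY y h
      nlinarith
    · exact h2.trans (mul_le_mul_of_nonneg_left h.le hl.le)
  · have hs0 : 0 < s := hl.trans_le hsl
    refine (mul_le_of_le_one_left hh0 hDle).trans ?_
    set k := ⌊s / l⌋₊ with hk
    have hkle : (k : ℝ) ≤ s / l := Nat.floor_le (by positivity)
    have hk1 : (1 : ℝ) ≤ k := by
      exact_mod_cast (Nat.one_le_floor_iff _).2 ((one_le_div hl).2 hsl)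
    have hklt : s / l < k + 1 := Nat.lt_floor_add_one _
    have hkle' : l * k ≤ s := by rw [le_div_iff₀ hl] at hkle; linarith
    have hkge : s ≤ 2 * (l * k) := by
      rw [div_lt_iff₀ hl] at hklt; nlinarith
    refine (hFun_le (weightMatrix_pos σ l) ht.le k).trans ?_
    rw [weightMatrix_mul_pow σ l ht, Real.exp_le_exp]
    -- The supporting line is scaled by `l k / s`, which lies in `[1/2, 1]`; since `φ_σ ≥ 0`, the
    -- scaled line still lies below `φ_σ`.
    have hconj : conjPhi σ (l * k) ≤ l * k * y - 1 / 2 * phi σ y := by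
      refine conjPhi_le fun v _ => ?_
      have h1 := hs v
      have h2 : l * k * (phi σ y + s * (v - y)) ≤ l * k * phi σ v :=
        mul_le_mul_of_nonneg_left h1 (by positivity)
      have h3 : l * k * phi σ v ≤ s * phi σ v := mul_le_mul_of_nonneg_right hkle' (hphin v)
      have h4 : s * (1 / 2 * phi σ y) ≤ l * k * phi σ y := by nlinarith [hphin y]
      refine le_of_mul_le_mul_left ?_ hs0
      nlinarith
    have h5 := mul_le_mul_of_nonneg_left hconj (one_div_nonneg.2 hl.le)
    have h6 : 1 / l * (l * k * y - 1 / 2 * phi σ y) = k * y - b * phi σ y := by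
      rw [hldef]; field_simp
    have h7 : (k : ℝ) * Real.log t = -(k * y) := by rw [hy]; ring
    linarith

/-! ### Optimal flat functions -/

theorem IsLC.le_of_quot_le {M N : ℕ → ℝ} (hM : IsLC M) (hN : IsLC N)
    (hMN : ∀ p, quot M p ≤ quot N p) (k : ℕ) : M k ≤ N k := by
  rw [← Real.log_le_log_iff (hM.pos k) (hN.pos k), hM.log_eq_sum, hN.log_eq_sum]
  exact Finset.sum_le_sum fun j _ => Real.log_le_log (hM.quot_pos _) (hMN _)

theorem hFun_le_hFun {M N : ℕ → ℝ} (hM : ∀ p, 0 < M p) (h : ∀ k, M k ≤ N k) {t : ℝ} (ht : 0 ≤ t) :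
    hFun M t ≤ hFun N t :=
  le_ciInf fun k => (hFun_le hM ht k).trans (mul_le_mul_of_nonneg_right (h k) (pow_nonneg ht k))

theorem norm_exp_neg_mul (a : ℝ) (z : ℂ) : ‖Complex.exp (-(a : ℂ) * z)‖ = Real.exp (-a * z.re) := by
  rw [Complex.norm_exp, ← Complex.ofReal_neg, Complex.re_ofReal_mul]

theorem sector_mono {γ γ' : ℝ} (h : γ ≤ γ') : sector γ ⊆ sector γ' := fun ξ hξ => by
  have h2 : |ξ.arg| < γ * Real.pi / 2 := hξ
  change |ξ.arg| < γ' * Real.pi / 2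
  refine h2.trans_le ?_
  have := Real.pi_pos
  gcongr

theorem HolomorphicOn.mono {G : LogSurface → ℂ} {S T : Set LogSurface} (h : HolomorphicOn G T)
    (hST : S ⊆ T) : HolomorphicOn G S :=
  DifferentiableOn.mono h fun _ hw => hST hw

theorem exists_lt_of_lt_biSup {P : ℝ → Prop} {γ : ℝ} (hγ : 0 < γ)
    (h : ENNReal.ofReal γ < ⨆ r ∈ {r : ℝ | 0 < r ∧ P r}, ENNReal.ofReal r) :
    ∃ r, γ < r ∧ P r := by
  obtain ⟨r, hr, hlt⟩ := lt_biSup_iff.1 h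
  exact ⟨r, (ENNReal.ofReal_lt_ofReal_iff_of_nonneg hγ.le).1 hlt, hr.2⟩

theorem exists_flat_of_sequences {M N : ℕ → ℝ} (hM : IsLC M) (hN : IsLC N)
    (hMN : ∀ p, quot M p ≤ quot N p) {γ : ℝ} (hγ : 0 < γ)
    (hidx : ENNReal.ofReal γ < seqIndex M N) :
    ∃ K₁ K₂ K₃ K₄ : ℝ, 0 < K₁ ∧ 0 < K₂ ∧ 0 < K₃ ∧ 0 < K₄ ∧
      ∀ a : ℝ, 0 < a → ∃ G : LogSurface → ℂ,
        HolomorphicOn G (sector γ) ∧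
        (∀ ξ ∈ sector γ,
          K₁ ^ (-a) * hFun M (K₁ * ξ.modulus) ^ (2 * a * K₂) ≤ ‖G ξ‖ ∧
          ‖G ξ‖ ≤ hFun N (K₃ * ξ.modulus) ^ (a * K₄ / 2)) ∧
        (ModerateGrowth N → G ∈ ultraClass (hat N) (sector γ) ∧ Flat G (sector γ)) ∧
        (ModerateGrowth M → ∃ K₅ : ℝ, 0 < K₅ ∧ ∀ ξ ∈ sector γ,
          K₁ ^ (-a) * hFun M (K₅ * ξ.modulus) ≤ ‖G ξ‖) := by
  obtain ⟨r, hr, hcond⟩ := exists_lt_of_lt_biSup hγ hidx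
  -- The construction is done on the larger sector `S_γ'`, leaving room for the Cauchy discs.
  obtain ⟨γ', hγ', hγr⟩ := exists_between hr
  obtain ⟨A, hA⟩ := hcond.exists_neg_log_hFun_le hM hN hMN (hγ.trans hr)
  have hlogM : ∀ s, 0 ≤ -Real.log (hFun M (Real.exp s)) := fun s =>
    neg_nonneg.2 (Real.log_nonpos (hFun_pos hM (Real.exp_pos s)).le
      (hFun_le_one hM.pos hM.zero_eq_one (Real.exp_pos s).le))
  have hlogN : ∀ s, 0 ≤ -Real.log (hFun N (Real.exp s)) := fun s =>
    neg_nonneg.2 (Real.log_nonpos (hFun_pos hN (Real.exp_pos s)).le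
      (hFun_le_one hN.pos hN.zero_eq_one (Real.exp_pos s).le))
  have hanti : Antitone fun s => -Real.log (hFun N (Real.exp s)) := fun s t hst =>
    neg_le_neg (Real.log_le_log (hFun_pos hN (Real.exp_pos s))
      (hFun_mono hN.pos (Real.exp_pos s).le (Real.exp_le_exp.2 hst)))
  obtain ⟨c, H, hc, hdiff, hH⟩ := exists_strip hanti hlogN (fun s => hlogM (s - 1))
    (hγ.trans hγ') hγr hA
  have him : ∀ w : ℂ, (w + ((c + 2 : ℝ) : ℂ)).im = w.im := fun w => by
    rw [Complex.add_im, Complex.ofReal_im, add_zero]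
  have hre : ∀ w : ℂ, (w + ((c + 2 : ℝ) : ℂ)).re = w.re + (c + 2) := fun w => by
    rw [Complex.add_re, Complex.ofReal_re]
  -- `H` is evaluated at `log ξ + c + 2`: `c` undoes the translation, 1 undoes the shift in `Φ`, and
  -- the last 1 makes the dilation equal to `e`, so that one `K₁` serves both as factor and as
  -- dilation.
  refine ⟨Real.exp 1, 1, Real.exp (c + 2), 1, Real.exp_pos _, one_pos, Real.exp_pos _, one_pos,
    fun a ha => ?_⟩
  set G : LogSurface → ℂ := fun ξ => Complex.exp (-(a : ℂ) * H (ξ.log + ((c + 2 : ℝ) : ℂ)))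
    with hG
  have hGhol : HolomorphicOn G (sector γ') := by
    refine Complex.differentiable_exp.comp_differentiableOn ((hdiff.comp ?_ fun w hw => ?_).const_mul _)
    · fun_prop
    · have h2 : |w.im| < γ' * Real.pi / 2 := hw
      change |(w + ((c + 2 : ℝ) : ℂ)).im| < _
      rwa [him]
  have hbound : ∀ ξ ∈ sector γ',
      Real.exp 1 ^ (-a) * hFun M (Real.exp 1 * ξ.modulus) ^ (2 * a * 1) ≤ ‖G ξ‖ ∧
      ‖G ξ‖ ≤ hFun N (Real.exp (c + 2) * ξ.modulus) ^ (a * 1 / 2) := by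
    intro ξ hξ
    have h2 : |ξ.log.im| < γ' * Real.pi / 2 := hξ
    obtain ⟨hlow, hup⟩ := hH (ξ.log + ((c + 2 : ℝ) : ℂ)) (by rwa [him])
    rw [hre] at hlow hup
    have e1 : Real.exp 1 * ξ.modulus = Real.exp (ξ.log.re + 1) := by
      rw [LogSurface.modulus, ← Real.exp_add, add_comm]
    have e2 : Real.exp (c + 2) * ξ.modulus = Real.exp (ξ.log.re + (c + 2)) := by
      rw [LogSurface.modulus, ← Real.exp_add, add_comm]
    rw [e1, e2, hG, norm_exp_neg_mul, Real.rpow_def_of_pos (hFun_pos hM (Real.exp_pos _)),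
      Real.rpow_def_of_pos (hFun_pos hN (Real.exp_pos _)), ← Real.exp_mul, ← Real.exp_add,
      Real.exp_le_exp, Real.exp_le_exp]
    constructor
    · have h3 : ξ.log.re + (c + 2) - c = ξ.log.re + 2 := by ring
      have h4 : ξ.log.re + 2 - 1 = ξ.log.re + 1 := by ring
      rw [h3, h4] at hup
      have h5 : -Real.log (hFun N (Real.exp (ξ.log.re + 2)))
          ≤ -Real.log (hFun N (Real.exp (ξ.log.re + 1))) := hanti (by linarith)
      have h6 := Real.log_le_log (hFun_pos hM (Real.exp_pos (ξ.log.re + 1)))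
        (hFun_le_hFun hM.pos (hM.le_of_quot_le hN hMN) (Real.exp_pos (ξ.log.re + 1)).le)
      have h7 : (H (ξ.log + ((c + 2 : ℝ) : ℂ))).re
          ≤ -2 * Real.log (hFun M (Real.exp (ξ.log.re + 1))) + 1 := by linarith
      have h8 := mul_le_mul_of_nonneg_left h7 ha.le
      linarith
    · have h8 := mul_le_mul_of_nonneg_left hlow ha.le
      linarith
  have hsub := sector_mono hγ'.le
  refine ⟨G, hGhol.mono hsub, fun ξ hξ => hbound ξ (hsub hξ), fun hmg => ?_, fun hmg => ?_⟩
  -- The exponent `2/a` is chosen to cancel the power `a/2` in the upper bound.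
  · obtain ⟨Q, hQ, hle⟩ := hmg.exists_hFun_le_rpow hN.pos hN.zero_eq_one (2 / a)
    refine mem_ultraClass_and_flat hN.pos (mul_pos hQ (Real.exp_pos (c + 2))) hγ' hGhol
      fun ξ hξ => (hbound ξ hξ).2.trans ?_
    have hm := ξ.modulus_pos
    have ht : 0 ≤ Real.exp (c + 2) * ξ.modulus := by positivity
    have hh0 : 0 ≤ hFun N (Q * (Real.exp (c + 2) * ξ.modulus)) :=
      hFun_nonneg hN.pos (by positivity)
    calc _ ≤ (hFun N (Q * (Real.exp (c + 2) * ξ.modulus)) ^ (2 / a)) ^ (a * 1 / 2) :=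
          Real.rpow_le_rpow (hFun_nonneg hN.pos ht) (hle _ ht) (by positivity)
      _ = hFun N (Q * Real.exp (c + 2) * ξ.modulus) := by
          rw [← Real.rpow_mul hh0, show 2 / a * (a * 1 / 2) = 1 by field_simp, Real.rpow_one,
            mul_assoc]
  · obtain ⟨Q, hQ, hle⟩ := hmg.exists_hFun_le_rpow hM.pos hM.zero_eq_one (2 * a * 1)
    refine ⟨Real.exp 1 / Q, by positivity, fun ξ hξ => le_trans ?_ (hbound ξ (hsub hξ)).1⟩
    have hm := ξ.modulus_pos
    refine mul_le_mul_of_nonneg_left ?_ (by positivity)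
    refine (hle _ (by positivity)).trans_eq ?_
    congr 2
    field_simp

/-- The case split makes `B = 1` whenever `ω - σ` is bounded above. Otherwise `B` is raised to at
least 1, so that `B + 1 ≤ 2B` later. -/
theorem WeightPreceq.exists_le {σ ω : ℝ → ℝ} (hσ : IsWeightFunction σ) (hω : IsWeightFunction ω)
    (h : WeightPreceq σ ω) :
    ∃ B C : ℝ, 1 ≤ B ∧ 0 ≤ C ∧ (∀ t, 0 ≤ t → ω t ≤ B * σ t + C) ∧
      ((∃ C : ℝ, ∀ t, 0 ≤ t → ω t ≤ σ t + C) → B = 1) := by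
  by_cases hb : ∃ C : ℝ, ∀ t, 0 ≤ t → ω t ≤ σ t + C
  · obtain ⟨C, hC⟩ := hb
    refine ⟨1, max C 0, le_rfl, le_max_right _ _, fun t ht => ?_, fun _ => rfl⟩
    linarith [hC t ht, le_max_left C 0]
  · obtain ⟨B, hB⟩ := Asymptotics.IsBigO.bound h
    obtain ⟨T, hT⟩ := eventually_atTop.1 hB
    refine ⟨max B 1, ω (max T 0), le_max_right _ _, hω.nonneg _ (le_max_right _ _),
      fun t ht => ?_, fun h' => absurd h' hb⟩
    have hσt := hσ.nonneg t ht
    rcases le_total t (max T 0) with h1 | h1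
    · have h2 := hω.monotoneOn (mem_Ici.2 ht) (mem_Ici.2 (le_max_right T 0)) h1
      have : 0 ≤ max B 1 * σ t := mul_nonneg (zero_le_one.trans (le_max_right _ _)) hσt
      linarith
    · have h2 := hT t ((le_max_left _ _).trans h1)
      rw [Real.norm_eq_abs, Real.norm_eq_abs, abs_of_nonneg (hω.nonneg t ht),
        abs_of_nonneg hσt] at h2
      have h3 := hω.nonneg _ (le_max_right T 0)
      have h4 := mul_le_mul_of_nonneg_right (le_max_left B 1) hσt
      linarith

theorem exists_flat_of_functions {σ ω : ℝ → ℝ} (hσ : IsWeightFunction σ) (hω : IsWeightFunction ω)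
    (hσω : WeightPreceq σ ω) {γ : ℝ} (hγ : 0 < γ) (hidx : ENNReal.ofReal γ < funIndex σ ω) :
    ∃ K₁ K₂ K₃ K₂' B : ℝ, 0 < K₁ ∧ 0 < K₂ ∧ 0 < K₃ ∧ 0 < K₂' ∧ 0 < B ∧
      ((∃ C : ℝ, ∀ t : ℝ, 0 ≤ t → ω t ≤ σ t + C) → B = 1) ∧
      ∀ a : ℝ, 0 < a → ∃ G : LogSurface → ℂ,
        HolomorphicOn G (sector γ) ∧
        (∀ ξ ∈ sector γ,
          K₁ ^ (-a) * Real.exp (-2 * a * B * iota σ (K₂ * ξ.modulus)) ≤ ‖G ξ‖ ∧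
          ‖G ξ‖ ≤ Real.exp (-(a / 2) * iota ω (K₃ * ξ.modulus))) ∧
        (Normalized ω → Omega3 ω →
          G ∈ ultraMatrixClass (fun x => hat (weightMatrix ω x)) (sector γ) ∧
          Flat G (sector γ) ∧
          ∀ ξ ∈ sector γ, ‖G ξ‖ ≤ hFun (weightMatrix ω (2 / a)) (K₂' * ξ.modulus)) ∧
        (IsW0 σ → ∃ x K₄ : ℝ, 0 < x ∧ 0 < K₄ ∧ ∀ ξ ∈ sector γ,
          K₄ * hFun (weightMatrix σ x) (K₂ * ξ.modulus) ≤ ‖G ξ‖) := by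
  obtain ⟨r, hr, hcond⟩ := exists_lt_of_lt_biSup hγ hidx
  obtain ⟨γ', hγ', hγr⟩ := exists_between hr
  obtain ⟨A, hA⟩ := hcond.exists_le_rpow hσ hω (hγ.trans hr)
  have hanti : Antitone fun s => ω (Real.exp (-s)) := fun s t hst =>
    hω.monotoneOn (mem_Ici.2 (Real.exp_pos _).le) (mem_Ici.2 (Real.exp_pos _).le)
      (Real.exp_le_exp.2 (neg_le_neg hst))
  obtain ⟨c, H, hc, hdiff, hH⟩ := exists_strip (Φ := fun s => σ (Real.exp (-s))) hanti
    (fun s => hω.nonneg _ (Real.exp_pos _).le) (fun s => hσ.nonneg _ (Real.exp_pos _).le)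
    (hγ.trans hγ') hγr (A := A) fun x v hv => by
      have h1 := hA (Real.exp (-x)) (Real.exp v) (Real.exp_pos _).le (Real.one_le_exp hv)
      rw [← Real.exp_add, ← Real.exp_mul] at h1
      rwa [neg_sub, sub_eq_neg_add, div_eq_mul_one_div v r]
  obtain ⟨B, C, hB, hC, hBC, hB1⟩ := hσω.exists_le hσ hω
  have hsub := sector_mono hγ'.le
  -- Here `Re H ≤ (B + 1) σ + C + 1 ≤ 2 B σ + (C + 1)` at the translated point; the translation
  -- becomes the dilation `K₂ = e^{-c}`.
  refine ⟨Real.exp (C + 1), Real.exp (-c), 1, 1, B, Real.exp_pos _, Real.exp_pos _, one_pos,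
    one_pos, one_pos.trans_le hB, hB1, fun a ha => ?_⟩
  set G : LogSurface → ℂ := fun ξ => Complex.exp (-(a : ℂ) * H ξ.log) with hG
  have hGhol : HolomorphicOn G (sector γ') :=
    Complex.differentiable_exp.comp_differentiableOn (DifferentiableOn.const_mul hdiff _)
  have hbound : ∀ ξ ∈ sector γ',
      Real.exp (C + 1) ^ (-a) * Real.exp (-2 * a * B * iota σ (Real.exp (-c) * ξ.modulus)) ≤ ‖G ξ‖ ∧
      ‖G ξ‖ ≤ Real.exp (-(a / 2) * iota ω (1 * ξ.modulus)) := by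
    intro ξ hξ
    obtain ⟨hlow, hup⟩ := hH ξ.log hξ
    have e1 : iota σ (Real.exp (-c) * ξ.modulus) = σ (Real.exp (-(ξ.log.re - c))) := by
      rw [iota, LogSurface.modulus, ← Real.exp_add, one_div, ← Real.exp_neg]
      ring_nf
    have e2 : iota ω (1 * ξ.modulus) = ω (Real.exp (-ξ.log.re)) := by
      rw [iota, LogSurface.modulus, one_mul, one_div, ← Real.exp_neg]
    rw [e1, e2, hG, norm_exp_neg_mul, ← Real.exp_mul, ← Real.exp_add, Real.exp_le_exp,
      Real.exp_le_exp]
    constructor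
    · have h1 := hBC (Real.exp (-(ξ.log.re - c))) (Real.exp_pos _).le
      have h2 := mul_le_mul_of_nonneg_right hB
        (hσ.nonneg (Real.exp (-(ξ.log.re - c))) (Real.exp_pos _).le)
      have h3 : (H ξ.log).re ≤ 2 * B * σ (Real.exp (-(ξ.log.re - c))) + (C + 1) := by linarith
      have h4 := mul_le_mul_of_nonneg_left h3 ha.le
      linarith
    · have h4 := mul_le_mul_of_nonneg_left hlow ha.le
      linarith
  refine ⟨G, hGhol.mono hsub, fun ξ hξ => hbound ξ (hsub hξ), fun hn h3 => ?_, fun hW => ?_⟩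
  · have hl : 0 < 2 / a := by positivity
    have hle : ∀ ξ ∈ sector γ', ‖G ξ‖ ≤ hFun (weightMatrix ω (2 / a)) (1 * ξ.modulus) := by
      intro ξ hξ
      have h1 := exp_neg_le_hFun_weightMatrix hω hn h3 hl
        (t := 1 * ξ.modulus) (by rw [one_mul]; exact ξ.modulus_pos)
      rw [one_div_div] at h1
      exact (hbound ξ hξ).2.trans h1
    obtain ⟨h1, h2⟩ := mem_ultraClass_and_flat (weightMatrix_pos ω (2 / a)) one_pos hγ' hGhol hle
    exact ⟨mem_iUnion₂.2 ⟨2 / a, hl, h1⟩, h2, fun ξ hξ => hle ξ (hsub hξ)⟩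
  · obtain ⟨l, D, hl, hD, hle⟩ := hW.exists_hFun_weightMatrix_le (b := 2 * a * B) (by positivity)
    refine ⟨l, Real.exp (C + 1) ^ (-a) * D, hl, by positivity, fun ξ hξ => ?_⟩
    refine le_trans ?_ (hbound ξ (hsub hξ)).1
    rw [mul_assoc]
    refine mul_le_mul_of_nonneg_left ?_ (by positivity)
    refine (hle _ (mul_pos (Real.exp_pos _) ξ.modulus_pos)).trans_eq ?_
    rw [iota]
    ring_nf

end MixedFlat

theorem mainTheorem2 :
    -- (I) weight sequences
    (∀ M N : ℕ → ℝ, MixedFlat.IsLC M → MixedFlat.IsLC N →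
      (∀ p, MixedFlat.quot M p ≤ MixedFlat.quot N p) →
      ∀ γ : ℝ, 0 < γ → ENNReal.ofReal γ < MixedFlat.seqIndex M N →
      ∃ K₁ K₂ K₃ K₄ : ℝ, 0 < K₁ ∧ 0 < K₂ ∧ 0 < K₃ ∧ 0 < K₄ ∧
        ∀ a : ℝ, 0 < a → ∃ G : MixedFlat.LogSurface → ℂ,
          MixedFlat.HolomorphicOn G (MixedFlat.sector γ) ∧
          (∀ ξ ∈ MixedFlat.sector γ,
            K₁ ^ (-a) * MixedFlat.hFun M (K₁ * ξ.modulus) ^ (2 * a * K₂) ≤ ‖G ξ‖ ∧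
            ‖G ξ‖ ≤ MixedFlat.hFun N (K₃ * ξ.modulus) ^ (a * K₄ / 2)) ∧
          (MixedFlat.ModerateGrowth N →
            G ∈ MixedFlat.ultraClass (MixedFlat.hat N) (MixedFlat.sector γ) ∧
            MixedFlat.Flat G (MixedFlat.sector γ)) ∧
          (MixedFlat.ModerateGrowth M →
            ∃ K₅ : ℝ, 0 < K₅ ∧ ∀ ξ ∈ MixedFlat.sector γ,
              K₁ ^ (-a) * MixedFlat.hFun M (K₅ * ξ.modulus) ≤ ‖G ξ‖)) ∧
    -- (II) weight functions
    (∀ σ ω : ℝ → ℝ, MixedFlat.IsWeightFunction σ → MixedFlat.IsWeightFunction ω →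
      MixedFlat.WeightPreceq σ ω →
      ∀ γ : ℝ, 0 < γ → ENNReal.ofReal γ < MixedFlat.funIndex σ ω →
      ∃ K₁ K₂ K₃ K₂' B : ℝ, 0 < K₁ ∧ 0 < K₂ ∧ 0 < K₃ ∧ 0 < K₂' ∧ 0 < B ∧
        ((∃ C : ℝ, ∀ t : ℝ, 0 ≤ t → ω t ≤ σ t + C) → B = 1) ∧
        ∀ a : ℝ, 0 < a → ∃ G : MixedFlat.LogSurface → ℂ,
          MixedFlat.HolomorphicOn G (MixedFlat.sector γ) ∧
          (∀ ξ ∈ MixedFlat.sector γ,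
            K₁ ^ (-a) * Real.exp (-2 * a * B * MixedFlat.iota σ (K₂ * ξ.modulus)) ≤ ‖G ξ‖ ∧
            ‖G ξ‖ ≤ Real.exp (-(a / 2) * MixedFlat.iota ω (K₃ * ξ.modulus))) ∧
          (MixedFlat.Normalized ω → MixedFlat.Omega3 ω →
            G ∈ MixedFlat.ultraMatrixClass
              (fun x => MixedFlat.hat (MixedFlat.weightMatrix ω x)) (MixedFlat.sector γ) ∧
            MixedFlat.Flat G (MixedFlat.sector γ) ∧
            ∀ ξ ∈ MixedFlat.sector γ,
              ‖G ξ‖ ≤ MixedFlat.hFun (MixedFlat.weightMatrix ω (2 / a)) (K₂' * ξ.modulus)) ∧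
          (MixedFlat.IsW0 σ →
            ∃ x K₄ : ℝ, 0 < x ∧ 0 < K₄ ∧ ∀ ξ ∈ MixedFlat.sector γ,
              K₄ * MixedFlat.hFun (MixedFlat.weightMatrix σ x) (K₂ * ξ.modulus) ≤ ‖G ξ‖)) := by
  refine ⟨fun M N hM hN hMN γ hγ hidx => ?_, fun σ ω hσ hω hσω γ hγ hidx => ?_⟩
  · exact MixedFlat.exists_flat_of_sequences hM hN hMN hγ hidx
  · exact MixedFlat.exists_flat_of_functions hσ hω hσω hγ hidx
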